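/- Let $d\ge 1$ and consider the spin chain with sites $\mathbb Z$ and one-site space $\mathbb C^d$. Let $\mathcal B$ be the set of linear operators on $\mathbb C^d$ and $\mathcal B_0\subset\mathcal B$ the traceless ones. A (formal) operator is a family $\Phi=\sum_A\Phi(A)$ with $\Phi(A)\in\mathcal B_0^{\otimes A}$, where $A$ ranges over the finite subsets of $\mathbb Z$ (and $\mathcal B_0^{\otimes\emptyset}=\mathbb C$). It is Hermitian if every $\Phi(A)$ is, and at most $n$-local if $\Phi(A)=0$ unless $A$ is contained in $n$ contiguous sites. Put $\Phi|_\Lambda=\sum_{A\subset\Lambda}\Phi(A)\otimes I_{\Lambda\setminus A}\in\mathcal B^{\otimes\Lambda}$ for finite $\Lambda$. For operators of finite range, the commutator is defined by $[\Phi,\Psi](A)=\big[\Phi|_\Lambda,\Psi|_\Lambda\big]_A$ for any sufficiently large finite $\Lambda\supset A$, where $Y_A$ denotes the component of $Y$ in the decomposition $\mathcal B^{\otimes\Lambda}=\bigoplus_{A\subset\Lambda}\mathcal B_0^{\otimes A}$. The translation $\mathcal T$ moves $\Phi(A+1)$ to the sites $A$, and $\Phi$ is translation-invariant if $\mathcal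 T(\Phi)=\Phi$. $\Psi$ is a conserved quantity of $H$ if $[H,\Psi]=0$. Let $H$ be a Hermitian, translation-invariant, at most two-local operator, and write $h^{(2)}_j=H(\{j,j+1\})$ and $h^{(1)}_j=H(\{j\})$. Assume: (1) for $a\in\mathcal B_0$, each of $[I\otimes a,h^{(2)}_1]=0$ and $[a\otimes I,h^{(2)}_1]=0$ implies $a=0$; (2) for every family $a_i\in\mathcal B_0\otimes\mathcal B_0$ of operators on the sites $\{i,i+1\}$ ($i\in\mathbb Z$), if $[h^{(2)}_i,a_{i+1}]=[a_i,h^{(2)}_{i+1}]$ for all $i$, then there is a constant $\alpha\in\mathbb C$ with $a_i=\alpha h^{(2)}_i$ for all $i$. Let $B$ be a Hermitian, at most two-local operator (not necessarily translation-invariant), and set $Q^{(2)}=H$ and $Q^{(n+1)}=[B,Q^{(n)}]$ for $n\ge 2$. Suppose that $Q^{(3)}=[B,H]$ is nonzero and is a conserved quantity of $H$. Then: (i) for every $n\ge 2$, $Q^{(n)}$ is an at most $n$-local, translation-invariant conserved quantity of $H$; (ii) $[Q^{(m)},Q^{(n)}]=0$ for all $m,n\ge 2$; (iii) there are real numbers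 $c\neq 0$ and $a$ and an at most one-local operator $R$ with $[H,\mathcal T(R)-R]=0$ such that $$B=c\Big(\sum_{j\in\mathbb Z}j\big(h^{(2)}_j+h^{(1)}_j\big)+R+aH\Big).$$ -/

import Mathlib

noncomputable section

namespace SpinChain

open Filter

/-- `𝓑^{⊗A}`: the linear operators on `(ℂ^d)^{⊗A}` for a finite set of sites `A ⊂ ℤ`, as matrices in
the product basis, which is indexed by the configurations `A → Fin d`. -/
abbrev Op (d : ℕ) (A : Finset ℤ) : Type := Matrix (A → Fin d) (A → Fin d) ℂ

/-- `𝓑₀^{⊗A}`: the span of the products of traceless one-site operators, that is, the operators on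
the sites `A` whose partial trace over each single site of `A` vanishes (`ℂ` for `A = ∅`). -/
def Op₀ (d : ℕ) (A : Finset ℤ) : Submodule ℂ (Op d A) where
  carrier := {X | ∀ (i : A) (s t : A → Fin d),
    ∑ k : Fin d, X (Function.update s i k) (Function.update t i k) = 0}
  zero_mem' := by intro i s t; simp
  add_mem' := by
    intro X Y hX hY i s t
    simp only [Matrix.add_apply, Finset.sum_add_distrib, hX i s t, hY i s t, add_zero]
  smul_mem' := by
    intro c X hX i s t
    simp only [Matrix.smul_apply, ← Finset.smul_sum, hX i s t, smul_zero]

/-- Formal operators `Φ = ∑_A Φ(A)` on the infinite chain: families `Φ(A) ∈ 𝓑₀^{⊗A}` indexed by the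
finite sets of sites. -/
abbrev FormalOp (d : ℕ) : Type := ∀ A : Finset ℤ, Op₀ d A

variable {d : ℕ}

/-- The restriction of a configuration on `B` to a subset `A`. -/
def restrictConfig {A B : Finset ℤ} (h : A ⊆ B) (s : B → Fin d) : A → Fin d :=
  fun i => s ⟨i, h i.2⟩

/-- The natural embedding `𝓑^{⊗A} → 𝓑^{⊗B}`, `X ↦ X ⊗ I_{B \ A}`. -/
def embed {A B : Finset ℤ} (h : A ⊆ B) (X : Op d A) : Op d B :=
  fun s t => if ∀ i : B, (i : ℤ) ∉ A → s i = t i then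
    X (restrictConfig h s) (restrictConfig h t) else 0

/-- The restriction `Φ|_B = ∑_{A ⊆ B} Φ(A) ∈ 𝓑^{⊗B}`. -/
def restrict (Φ : FormalOp d) (B : Finset ℤ) : Op d B :=
  ∑ A ∈ B.powerset.attach, embed (Finset.mem_powerset.1 A.2) (Φ A.1 : Op d A.1)

/-- The kernel of the map `X ↦ X - (tr X / d) I` on one-site operators:
its value at `X` has the entries `∑ a' b', tracelessKernel a b a' b' * X a' b'`. -/
def tracelessKernel (a b a' b' : Fin d) : ℂ :=
  (if a = a' ∧ b = b' then 1 else 0) - (d : ℂ)⁻¹ * (if a = b ∧ a' = b' then 1 else 0)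

/-- The projection `Y ↦ Y_A` of `𝓑^{⊗B} = ⨁_{A ⊆ B} 𝓑₀^{⊗A}` onto the component `A`, as an operator
on the sites `A`: the tensor product over the sites of `B` of the map `X ↦ X - (tr X / d) I` at the
sites of `A` and of the normalized trace `X ↦ tr X / d` at the other sites. -/
def componentOp {A B : Finset ℤ} (h : A ⊆ B) (Y : Op d B) : Op d A :=
  fun s t => ∑ s' : B → Fin d, ∑ t' : B → Fin d,
    (∏ i : A, tracelessKernel (s i) (t i) (s' ⟨i, h i.2⟩) (t' ⟨i, h i.2⟩)) *
    (∏ i : B, if (i : ℤ) ∈ A then 1 else (d : ℂ)⁻¹ * (if s' i = t' i then 1 else 0)) * Y s' t'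

theorem sum_tracelessKernel (a' b' : Fin d) : ∑ k : Fin d, tracelessKernel k k a' b' = 0 := by
  have hd : (d : ℂ) ≠ 0 := by
    have := a'.pos
    exact_mod_cast this.ne'
  simp only [tracelessKernel, true_and, Finset.sum_sub_distrib, Finset.sum_const,
    Finset.card_univ, Fintype.card_fin, nsmul_eq_mul]
  by_cases hab : a' = b'
  · subst hab
    simp [hd]
  · have : ∀ k : Fin d, ¬ (k = a' ∧ k = b') := fun k hk => hab (hk.1.symm.trans hk.2)
    simp [this, hab]

theorem componentOp_mem {A B : Finset ℤ} (h : A ⊆ B) (Y : Op d B) : componentOp h Y ∈ Op₀ d A := by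
  intro i s t
  simp only [componentOp]
  rw [Finset.sum_comm]
  refine Finset.sum_eq_zero fun s' _ => ?_
  rw [Finset.sum_comm]
  refine Finset.sum_eq_zero fun t' _ => ?_
  rw [← Finset.sum_mul, ← Finset.sum_mul]
  have key : ∑ k : Fin d, ∏ j : A, tracelessKernel (Function.update s i k j)
      (Function.update t i k j) (s' ⟨j, h j.2⟩) (t' ⟨j, h j.2⟩) = 0 := by
    have hk : ∀ k : Fin d, ∏ j : A, tracelessKernel (Function.update s i k j)
        (Function.update t i k j) (s' ⟨j, h j.2⟩) (t' ⟨j, h j.2⟩) =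
        tracelessKernel k k (s' ⟨i, h i.2⟩) (t' ⟨i, h i.2⟩) *
        ∏ j ∈ Finset.univ.erase i, tracelessKernel (s j) (t j) (s' ⟨j, h j.2⟩) (t' ⟨j, h j.2⟩) := by
      intro k
      rw [← Finset.mul_prod_erase _ _ (Finset.mem_univ i)]
      congr 1
      · simp
      · refine Finset.prod_congr rfl fun j hj => ?_
        rw [Function.update_of_ne (Finset.ne_of_mem_erase hj),
          Function.update_of_ne (Finset.ne_of_mem_erase hj)]
    simp only [hk]
    rw [← Finset.sum_mul, sum_tracelessKernel, zero_mul]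
  rw [key, zero_mul, zero_mul]

/-- The component `Y_A ∈ 𝓑₀^{⊗A}` of `Y ∈ 𝓑^{⊗B}`. -/
def component {A B : Finset ℤ} (h : A ⊆ B) (Y : Op d B) : Op₀ d A :=
  ⟨componentOp h Y, componentOp_mem h Y⟩

open Classical in
/-- The commutator `[Φ, Ψ]`: its component at `A` is the value of `[Φ|_B, Ψ|_B]_A` for all
sufficiently large finite `B ⊇ A`. This value exists when `Φ` or `Ψ` has finite range; the default
`0` is never used then. -/
def opComm (Φ Ψ : FormalOp d) : FormalOp d := fun A =>
  if h : ∃ X : Op₀ d A, ∀ᶠ B : Finset ℤ in atTop, ∀ hAB : A ⊆ B,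
    component hAB (restrict Φ B * restrict Ψ B - restrict Ψ B * restrict Φ B) = X
  then h.choose else 0

/-- `Ψ` is a conserved quantity of `Φ`. -/
def IsConserved (Φ Ψ : FormalOp d) : Prop := opComm Φ Ψ = 0

/-- `Φ† = Φ`. -/
def IsSelfAdj (Φ : FormalOp d) : Prop := ∀ A, (Φ A : Op d A).IsHermitian

/-- `Φ` is at most `n`-local: each of its terms acts on at most `n` contiguous sites
`i, i + 1, …, i + n - 1`. -/
def AtMostLocal (n : ℕ) (Φ : FormalOp d) : Prop :=
  ∀ A, Φ A ≠ 0 → ∃ i : ℤ, A ⊆ Finset.Ico i (i + n)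

/-- `A + 1`. -/
def shift (A : Finset ℤ) : Finset ℤ := A.map (addRightEmbedding 1)

/-- The configuration on `A + 1` which has at `i + 1` the value of `s` at `i`. -/
def shiftConfig {A : Finset ℤ} (s : A → Fin d) : shift A → Fin d :=
  fun j => s ⟨j - 1, by
    obtain ⟨i, hi, hij⟩ := Finset.mem_map.1 j.2
    simpa [← hij] using hi⟩

theorem shiftConfig_update {A : Finset ℤ} (s : A → Fin d) (i : A) (k : Fin d) :
    shiftConfig (Function.update s i k) =
      Function.update (shiftConfig s)
        ⟨(i : ℤ) + 1, Finset.mem_map.2 ⟨i, i.2, rfl⟩⟩ k := by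
  funext j
  by_cases hj : (j : ℤ) = i + 1
  · have h1 : j = ⟨(i : ℤ) + 1, Finset.mem_map.2 ⟨i, i.2, rfl⟩⟩ := Subtype.ext hj
    subst h1
    have h2 : (⟨(i : ℤ) + 1 - 1, by simp⟩ : A) = i := Subtype.ext (by simp)
    simp only [shiftConfig, Function.update_self]
    rw [h2, Function.update_self]
  · rw [Function.update_of_ne (fun h => hj (congrArg Subtype.val h))]
    simp only [shiftConfig]
    rw [Function.update_of_ne]
    intro h
    have := congrArg Subtype.val h
    simp only at this
    omega

/-- The translation `𝓣(Φ)(A) = τ† Φ(A + 1) τ`, where `τ` is the unitary shift of the sites `A` to the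
sites `A + 1`. -/
def translateOp (Φ : FormalOp d) : FormalOp d := fun A =>
  ⟨fun s t => (Φ (shift A) : Op d (shift A)) (shiftConfig s) (shiftConfig t), by
    intro i s t
    simp only [shiftConfig_update]
    exact (Φ (shift A)).2 _ _ _⟩

/-- The standard boost `∑_j j (h_j^{(2)} + h_j^{(1)})`, where `h_j^{(2)} = H({j, j + 1})` and
`h_j^{(1)} = H({j})`: each term of `H` is multiplied by its leftmost site. -/
def standardBoost (H : FormalOp d) : FormalOp d := fun A =>
  if h : A.Nonempty then ((A.min' h : ℤ) : ℂ) • H A else 0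

/-- The operators `Q^{(2)} = H`, `Q^{(n+1)} = [B, Q^{(n)}]` (used for `n ≥ 2` only). -/
def charge (H B : FormalOp d) (n : ℕ) : FormalOp d := (opComm B)^[n - 2] H

/-- The injectivity assumption on `h_1^{(2)} = H({1, 2})`: a traceless one-site operator `a` with
`[I ⊗ a, h_1^{(2)}] = 0` or with `[a ⊗ I, h_1^{(2)}] = 0` is zero. -/
def InjectiveInteraction (H : FormalOp d) : Prop :=
  (∀ a : Op₀ d {2}, Commute (embed (B := {1, 2}) (by simp) (a : Op d {2})) (H {1, 2} : Op d {1, 2}) →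
    a = 0) ∧
  (∀ a : Op₀ d {1}, Commute (embed (B := {1, 2}) (by simp) (a : Op d {1})) (H {1, 2} : Op d {1, 2}) →
    a = 0)

/-- The commutator in `𝓑^{⊗{i, i+1, i+2}}` of an operator on `{i, i+1}` with one on `{i+1, i+2}`. -/
def adjacentComm (i : ℤ) (x : Op₀ d {i, i + 1}) (y : Op₀ d {i + 1, i + 1 + 1}) :
    Op d {i, i + 1, i + 1 + 1} :=
  let X : Op d {i, i + 1, i + 1 + 1} :=
    embed (A := {i, i + 1})
      (by intro j; simp only [Finset.mem_insert, Finset.mem_singleton]; tauto) x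
  let Y : Op d {i, i + 1, i + 1 + 1} :=
    embed (A := {i + 1, i + 1 + 1})
      (by intro j; simp only [Finset.mem_insert, Finset.mem_singleton]; tauto) y
  X * Y - Y * X

/-- The assumption that, for every family `a_i ∈ 𝓑₀ ⊗ 𝓑₀` on `{i, i+1}`, the relations
`[h_i^{(2)}, a_{i+1}] = [a_i, h_{i+1}^{(2)}]` for all `i` imply `a_i = α h_i^{(2)}` for all `i`, with a
constant `α ∈ ℂ` independent of `i`. -/
def OneDimTwoLocal (H : FormalOp d) : Prop :=
  ∀ a : ∀ i : ℤ, Op₀ d {i, i + 1},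
    (∀ i : ℤ, adjacentComm i (H {i, i + 1}) (a (i + 1)) =
      adjacentComm i (a i) (H {i + 1, i + 1 + 1})) →
    ∃ α : ℂ, ∀ i : ℤ, a i = α • H {i, i + 1}

end SpinChain

end

open SpinChain

/-!
All local operators act on the functions of the configurations of the chain, and there the operators
of finite range form a Lie algebra on which the translation `𝓣` is an automorphism.

Suppose that `[H, [B, H]] = 0`. By injectivity of `h⁽²⁾`, its components on four sites factor the
components `c_i` of `[B, H]` on three sites as `c_i = [h_i⁽²⁾, a_{i+1}] = [a_i, h_{i+1}⁽²⁾]`, whence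
`a_i = α h_i⁽²⁾`. Comparing with `c_i` in terms of `B`, and using the second assumption once more,
the two-site terms of `B` are `(α i + β) h_i⁽²⁾`. Self-adjointness makes `α` and `β` real, and
`α = 0` would make `B - β H` one-local, which is impossible as `[B, H] ≠ 0`. Hence
`B = c (∑ j h_j + R + a H)` with `R` one-local, and `𝓣(B) - B = c (H + 𝓣(R) - R)` up to scalars.

The analytic input is positivity of the trace per site. If `H` and `Ψ` are translation-invariant and
`G = [H, Ψ]` commutes with `H`, then the trace per site of `G† G = G† [H, Ψ]` equals that of
`[G†, H] Ψ = 0`, so `G = 0`. A similar trace argument applies when `Ψ` is one-local. Inductively, if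
`Q⁽ⁿ⁾` is conserved and invariant, then `𝓣(B) - B` commutes with it, so `Q⁽ⁿ⁺¹⁾ = [B, Q⁽ⁿ⁾]` is
invariant; by the Jacobi identity `[H, [H, Q⁽ⁿ⁺¹⁾]] = 0`, so `Q⁽ⁿ⁺¹⁾` is conserved.
-/

noncomputable section

namespace SpinChain

open Filter

variable {d : ℕ}

/-! ### Commuting families in Lie algebras -/

section Lie

variable {L : Type*} [LieRing L]

theorem lie_iterate_eq_zero {b x : L} (h : ∀ n, ⁅x, (⁅b, ·⁆)^[n] x⁆ = 0) (m n : ℕ) :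
    ⁅(⁅b, ·⁆)^[m] x, (⁅b, ·⁆)^[n] x⁆ = 0 := by
  induction m generalizing n with
  | zero => exact h n
  | succ m ih =>
    have hn := ih (n + 1)
    simp only [Function.iterate_succ_apply'] at hn ⊢
    rw [lie_lie, ih n, lie_zero, hn, sub_zero]

theorem lie_iterate_eq_zero_of_double_lie {H B : L} (V : Set L)
    (hV : ∀ S ∈ V, ⁅H, ⁅H, S⁆⁆ = 0 → ⁅H, S⁆ = 0) (hVB : ∀ S ∈ V, ⁅H, S⁆ = 0 → ⁅S, B⁆ ∈ V)
    (hB : ⁅H, ⁅H, B⁆⁆ = 0) {S : L} (hS : S ∈ V) (hHS : ⁅H, S⁆ = 0) (n : ℕ) :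
    ⁅S, (⁅B, ·⁆)^[n] H⁆ = 0 := by
  induction n generalizing S with
  | zero => rw [Function.iterate_zero_apply, ← lie_skew, hHS, neg_zero]
  | succ n ih =>
    have hSB : ⁅H, ⁅S, B⁆⁆ = 0 := by
      have h : ⁅H, ⁅S, B⁆⁆ = ⁅S, ⁅H, B⁆⁆ := by rw [leibniz_lie, hHS, zero_lie, zero_add]
      refine hV _ (hVB S hS hHS) ?_
      rw [h, leibniz_lie, hHS, zero_lie, zero_add, hB, lie_zero]
    rw [Function.iterate_succ_apply', leibniz_lie, ih (hVB S hS hHS) hSB, ih hS hHS, lie_zero,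
      add_zero]

theorem lie_iterate_invariant_of_double_lie {R : Type*} [CommRing R] [LieAlgebra R L]
    {H B : L} (T : L →ₗ⁅R⁆ L) (hTH : T H = H)
    (hH : ∀ Ψ, T Ψ = Ψ → ⁅H, ⁅H, Ψ⁆⁆ = 0 → ⁅H, Ψ⁆ = 0) (hB : ⁅H, ⁅H, B⁆⁆ = 0)
    (hTB : ∀ n, ⁅H, (⁅B, ·⁆)^[n] H⁆ = 0 → ⁅T B - B, (⁅B, ·⁆)^[n] H⁆ = 0) (n : ℕ) :
    T ((⁅B, ·⁆)^[n] H) = (⁅B, ·⁆)^[n] H ∧ ⁅H, (⁅B, ·⁆)^[n] H⁆ = 0 := by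
  induction n with
  | zero => exact ⟨hTH, lie_self H⟩
  | succ n ih =>
    obtain ⟨hT, hQ⟩ := ih
    rw [Function.iterate_succ_apply']
    have hinv : T ⁅B, (⁅B, ·⁆)^[n] H⁆ = ⁅B, (⁅B, ·⁆)^[n] H⁆ := by
      rw [LieHom.map_lie, hT, ← sub_eq_zero, ← sub_lie, hTB n hQ]
    refine ⟨hinv, hH _ hinv ?_⟩
    rw [leibniz_lie H B, hQ, lie_zero, add_zero, leibniz_lie, hB, zero_lie, hQ, lie_zero, add_zero]

end Lie

open scoped Matrix ComplexOrder in
/- If `G = [H, S]` commutes with `H`, then `tr (G† G) = tr (G† [H, S]) = tr ([G†, H] S) = 0`. -/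
theorem lie_eq_zero_of_isHermitian {n : Type*} [Fintype n] {H : Matrix n n ℂ}
    (hH : H.IsHermitian) {S : Matrix n n ℂ} (h : ⁅H, ⁅H, S⁆⁆ = 0) : ⁅H, S⁆ = 0 := by
  have hG : ⁅H, S⁆ᴴ * H = H * ⁅H, S⁆ᴴ := by
    have := congrArg Matrix.conjTranspose (sub_eq_zero.1 h)
    simpa only [Matrix.conjTranspose_mul, hH.eq] using this
  rw [← Matrix.trace_conjTranspose_mul_self_eq_zero_iff]
  have hlie : ⁅H, S⁆ᴴ * ⁅H, S⁆ = ⁅H, S⁆ᴴ * (H * S) - ⁅H, S⁆ᴴ * (S * H) := by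
    rw [← Matrix.mul_sub, ← Ring.lie_def]
  rw [hlie, Matrix.trace_sub, ← Matrix.mul_assoc, hG, Matrix.mul_assoc, Matrix.trace_mul_comm H,
    Matrix.mul_assoc, sub_self]

/-! ### Operators on the infinite chain -/

/-- The linear operators on the functions of the configurations of the infinite chain, a common
home for the operators on all finite sets of sites. -/
abbrev Chain (d : ℕ) : Type := Module.End ℂ ((ℤ → Fin d) → ℂ)

instance : LieRing (Chain d) := LieRing.ofAssociativeRing

instance : LieAlgebra ℂ (Chain d) := LieAlgebra.ofAssociativeAlgebra

/-- The restriction of a configuration of the chain to the sites `A`. -/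
def siteRestrict (A : Finset ℤ) (s : ℤ → Fin d) : A → Fin d := fun i => s i

/-- The configuration `s` of the chain with its values on `A` replaced by `t`. -/
def glue {A : Finset ℤ} (s : ℤ → Fin d) (t : A → Fin d) : ℤ → Fin d :=
  fun i => if h : i ∈ A then t ⟨i, h⟩ else s i

theorem glue_of_notMem {A : Finset ℤ} (s : ℤ → Fin d) (t : A → Fin d) {i : ℤ} (h : i ∉ A) :
    glue s t i = s i := by simp [glue, h]

@[simp] theorem siteRestrict_glue {A : Finset ℤ} (s : ℤ → Fin d) (t : A → Fin d) :
    siteRestrict A (glue s t) = t := by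
  funext i; simp [siteRestrict, glue]

@[simp] theorem glue_glue {A : Finset ℤ} (s : ℤ → Fin d) (t u : A → Fin d) :
    glue (glue s t) u = glue s u := by
  funext i; by_cases h : i ∈ A <;> simp [glue, h]

@[simp] theorem glue_siteRestrict {A : Finset ℤ} (s : ℤ → Fin d) :
    glue s (siteRestrict A s) = s := by
  funext i; by_cases h : i ∈ A <;> simp [glue, h, siteRestrict]

theorem siteRestrict_glue_of_disjoint {A B : Finset ℤ} (h : Disjoint A B) (s : ℤ → Fin d)
    (t : A → Fin d) : siteRestrict B (glue s t) = siteRestrict B s := by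
  funext i
  exact glue_of_notMem s t (Finset.disjoint_right.1 h i.2)

theorem glue_comm_of_disjoint {A B : Finset ℤ} (h : Disjoint A B) (s : ℤ → Fin d)
    (t : A → Fin d) (u : B → Fin d) : glue (glue s t) u = glue (glue s u) t := by
  funext i
  by_cases hA : i ∈ A
  · have hB := Finset.disjoint_left.1 h hA
    simp [glue, hA, hB]
  · simp [glue, hA]

/-- The inclusion of the operators on the sites `A` into the operators on the chain. -/
def toChain (A : Finset ℤ) : Op d A →ₐ[ℂ] Chain d :=
  AlgHom.ofLinearMap
    { toFun := fun X =>
        { toFun := fun f s => ∑ t, X (siteRestrict A s) t * f (glue s t)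
          map_add' := by
            intro f g; funext s; simp [mul_add, Finset.sum_add_distrib]
          map_smul' := by
            intro c f; funext s
            simp only [Pi.smul_apply, smul_eq_mul, RingHom.id_apply, Finset.mul_sum]
            exact Finset.sum_congr rfl fun t _ => by ring }
      map_add' := by
        intro X Y; ext f s; simp [add_mul, Finset.sum_add_distrib]
      map_smul' := by
        intro c X
        refine LinearMap.ext fun f => funext fun s => ?_
        simp [Finset.mul_sum, mul_assoc] }
    (by
      refine LinearMap.ext fun f => funext fun s => ?_
      simp [Matrix.one_apply])
    (by
      intro X Y
      refine LinearMap.ext fun f => funext fun s => ?_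
      simp only [LinearMap.coe_mk, AddHom.coe_mk, Matrix.mul_apply, Finset.sum_mul,
        Module.End.mul_apply, siteRestrict_glue, glue_glue, Finset.mul_sum]
      rw [Finset.sum_comm]
      exact Finset.sum_congr rfl fun t _ => Finset.sum_congr rfl fun u _ => by ring)

theorem toChain_apply (A : Finset ℤ) (X : Op d A) (f : (ℤ → Fin d) → ℂ) (s : ℤ → Fin d) :
    toChain A X f s = ∑ t, X (siteRestrict A s) t * f (glue s t) := rfl

theorem toChain_injective [NeZero d] (A : Finset ℤ) :
    Function.Injective (toChain (d := d) A) := by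
  classical
  intro X Y h
  ext s t
  have h1 := congrFun (LinearMap.congr_fun h (Pi.single (glue (fun _ => 0) t) 1))
    (glue (fun _ => 0) s)
  simp only [toChain_apply, siteRestrict_glue, glue_glue] at h1
  have inj : ∀ u : A → Fin d, glue (fun _ => 0) u = glue (fun _ => (0 : Fin d)) t ↔ u = t := by
    intro u
    refine ⟨fun hu => ?_, fun hu => by rw [hu]⟩
    rw [← siteRestrict_glue (fun _ => (0 : Fin d)) u, hu, siteRestrict_glue]
  simpa [Pi.single_apply, inj] using h1

theorem toChain_embed {A B : Finset ℤ} (h : A ⊆ B) (X : Op d A) :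
    toChain B (embed h X) = toChain A X := by
  classical
  refine LinearMap.ext fun f => funext fun s => ?_
  simp only [toChain_apply, embed, ite_mul, zero_mul]
  rw [← Finset.sum_filter]
  refine Finset.sum_bij' (fun t _ => restrictConfig h t)
    (fun u _ => siteRestrict B (glue s u)) ?_ ?_ ?_ ?_ ?_
  · intro t _; exact Finset.mem_univ _
  · intro u _
    simp only [Finset.mem_filter, Finset.mem_univ, true_and]
    intro i hi
    simp [siteRestrict, glue, hi]
  · intro t ht
    simp only [Finset.mem_filter, Finset.mem_univ, true_and] at ht
    funext i
    by_cases hi : (i : ℤ) ∈ A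
    · simp [siteRestrict, glue, hi, restrictConfig]
    · simp only [siteRestrict, glue, hi, dif_neg, not_false_iff]
      exact ht i hi
  · intro u _
    funext i
    simp [siteRestrict, glue, restrictConfig]
  · intro t ht
    simp only [Finset.mem_filter, Finset.mem_univ, true_and] at ht
    congr 2
    funext i
    by_cases hA : i ∈ A
    · simp [glue, hA, h hA, restrictConfig]
    · by_cases hB : i ∈ B
      · simpa [glue, hA, hB, siteRestrict] using (ht ⟨i, hB⟩ hA).symm
      · simp [glue, hA, hB]

/-- The operators on the chain which act on the sites `A`. -/
def localAlg (d : ℕ) (A : Finset ℤ) : Subalgebra ℂ (Chain d) := (toChain A).range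

theorem toChain_mem (A : Finset ℤ) (X : Op d A) : toChain A X ∈ localAlg d A := ⟨X, rfl⟩

theorem localAlg_mono {A B : Finset ℤ} (h : A ⊆ B) : localAlg d A ≤ localAlg d B := by
  rintro _ ⟨X, rfl⟩
  exact ⟨embed h X, toChain_embed h X⟩

theorem localAlg_le_centralizer {A B : Finset ℤ} (h : Disjoint A B) :
    localAlg d A ≤ Subalgebra.centralizer ℂ (localAlg d B : Set (Chain d)) := by
  rintro _ ⟨X, rfl⟩
  rw [Subalgebra.mem_centralizer_iff]
  rintro _ ⟨Y, rfl⟩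
  refine LinearMap.ext fun f => funext fun s => ?_
  change toChain B Y (toChain A X f) s = toChain A X (toChain B Y f) s
  simp only [toChain_apply, siteRestrict_glue_of_disjoint h, siteRestrict_glue_of_disjoint h.symm,
    Finset.mul_sum]
  rw [Finset.sum_comm]
  refine Finset.sum_congr rfl fun t _ => Finset.sum_congr rfl fun u _ => ?_
  rw [glue_comm_of_disjoint h]
  ring

theorem commute_of_disjoint {A B : Finset ℤ} (h : Disjoint A B) {X Y : Chain d}
    (hX : X ∈ localAlg d A) (hY : Y ∈ localAlg d B) : Commute X Y :=
  ((Subalgebra.mem_centralizer_iff ℂ).1 (localAlg_le_centralizer h hX) Y hY).symm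

theorem lie_mem_localAlg {A : Finset ℤ} {X Y : Chain d} (hX : X ∈ localAlg d A)
    (hY : Y ∈ localAlg d A) : ⁅X, Y⁆ ∈ localAlg d A := by
  rw [Ring.lie_def]
  exact sub_mem (mul_mem hX hY) (mul_mem hY hX)

theorem lie_eq_zero_of_disjoint {A B : Finset ℤ} (h : Disjoint A B) {X Y : Chain d}
    (hX : X ∈ localAlg d A) (hY : Y ∈ localAlg d B) : ⁅X, Y⁆ = 0 :=
  (commute_of_disjoint h hX hY).lie_eq

/-! ### Matrix units and slices -/

/-- The matrix unit `|s⟩⟨t|` on the sites `A`. -/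
def unit (A : Finset ℤ) (s t : A → Fin d) : Chain d := toChain A (Matrix.single s t 1)

theorem unit_mem (A : Finset ℤ) (s t : A → Fin d) : unit A s t ∈ localAlg d A := toChain_mem _ _

theorem unit_mul_unit {A : Finset ℤ} (s t u v : A → Fin d) :
    unit A s t * unit A u v = if t = u then unit A s v else 0 := by
  rw [unit, unit, ← map_mul]
  split_ifs with h
  · rw [h, Matrix.single_mul_single_same, one_mul, unit]
  · rw [Matrix.single_mul_single_of_ne (h := h), map_zero]

theorem sum_unit (A : Finset ℤ) : ∑ s : A → Fin d, unit A s s = 1 := by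
  simp only [unit]
  rw [← map_sum, ← map_one (toChain A)]
  congr 1
  ext s t
  simp [Matrix.sum_apply, Matrix.single_apply, Matrix.one_apply, ite_and]

theorem toChain_eq_sum_unit {A : Finset ℤ} (X : Op d A) :
    toChain A X = ∑ s, ∑ t, X s t • unit A s t := by
  conv_lhs => rw [Matrix.matrix_eq_sum_single X]
  simp only [map_sum, unit, ← map_smul, Matrix.smul_single, smul_eq_mul, mul_one]

theorem unit_apply {A : Finset ℤ} (s t : A → Fin d) (f : (ℤ → Fin d) → ℂ) (r : ℤ → Fin d) :
    unit A s t f r = if siteRestrict A r = s then f (glue r t) else 0 := by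
  rw [unit, toChain_apply]
  simp only [Matrix.single_apply]
  by_cases h : siteRestrict A r = s
  · simp [h]
  · simp [h, Ne.symm h]

theorem unit_union {A B : Finset ℤ} (h : Disjoint A B) (s t : (A ∪ B : Finset ℤ) → Fin d) :
    unit (A ∪ B) s t =
      unit A (restrictConfig Finset.subset_union_left s)
        (restrictConfig Finset.subset_union_left t) *
      unit B (restrictConfig Finset.subset_union_right s)
        (restrictConfig Finset.subset_union_right t) := by
  refine LinearMap.ext fun f => funext fun r => ?_
  rw [Module.End.mul_apply, unit_apply, unit_apply, unit_apply,
    siteRestrict_glue_of_disjoint h, ← ite_and]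
  have h1 : siteRestrict (A ∪ B) r = s ↔
      siteRestrict A r = restrictConfig Finset.subset_union_left s ∧
      siteRestrict B r = restrictConfig Finset.subset_union_right s := by
    constructor
    · rintro rfl; exact ⟨rfl, rfl⟩
    · rintro ⟨h1, h2⟩
      funext ⟨i, hi⟩
      rcases Finset.mem_union.1 hi with hi | hi
      · exact congrFun h1 ⟨i, hi⟩
      · exact congrFun h2 ⟨i, hi⟩
  have h2 : glue (glue r (restrictConfig Finset.subset_union_left t))
      (restrictConfig Finset.subset_union_right t) = glue r t := by
    funext i
    by_cases hA : i ∈ A <;> by_cases hB : i ∈ B <;> simp [glue, hA, hB, restrictConfig]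
  simp only [h1, h2]

theorem localAlg_union_induction {A B : Finset ℤ} (h : Disjoint A B) (p : Submodule ℂ (Chain d))
    (hp : ∀ X ∈ localAlg d A, ∀ Y ∈ localAlg d B, X * Y ∈ p) {X : Chain d}
    (hX : X ∈ localAlg d (A ∪ B)) : X ∈ p := by
  obtain ⟨X, rfl⟩ := hX
  change toChain (A ∪ B) X ∈ p
  rw [toChain_eq_sum_unit]
  refine Submodule.sum_mem _ fun s _ => Submodule.sum_mem _ fun t _ => p.smul_mem _ ?_
  rw [unit_union h]
  exact hp _ (unit_mem _ _ _) _ (unit_mem _ _ _)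

/-- The coefficient, acting outside `A`, of the matrix unit `unit A s t` in the expansion of an
operator on the chain. -/
def slice (A : Finset ℤ) (s t : A → Fin d) : Chain d →ₗ[ℂ] Chain d :=
  ∑ u, LinearMap.mulLeft ℂ (unit A u s) ∘ₗ LinearMap.mulRight ℂ (unit A t u)

theorem slice_apply (A : Finset ℤ) (s t : A → Fin d) (X : Chain d) :
    slice A s t X = ∑ u, unit A u s * (X * unit A t u) := by
  simp [slice]

theorem eq_sum_slice_mul_unit (A : Finset ℤ) (X : Chain d) :
    X = ∑ s, ∑ t, slice A s t X * unit A s t := by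
  simp only [slice_apply, Finset.sum_mul, mul_assoc, unit_mul_unit]
  simp only [mul_ite, mul_zero, Finset.sum_ite_eq', Finset.mem_univ, if_true]
  simp only [← Finset.mul_sum, ← Finset.sum_mul, sum_unit, one_mul, mul_one]

theorem slice_mul_left {A : Finset ℤ} {X : Chain d}
    (hX : X ∈ Subalgebra.centralizer ℂ (localAlg d A : Set (Chain d)))
    (s t : A → Fin d) (Y : Chain d) : slice A s t (X * Y) = X * slice A s t Y := by
  simp only [slice_apply, Finset.mul_sum]
  refine Finset.sum_congr rfl fun u _ => ?_
  rw [mul_assoc X, ← mul_assoc, hX _ (unit_mem A u s), mul_assoc]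

theorem slice_mul_right {A : Finset ℤ} {X : Chain d}
    (hX : X ∈ Subalgebra.centralizer ℂ (localAlg d A : Set (Chain d)))
    (s t : A → Fin d) (Y : Chain d) : slice A s t (Y * X) = slice A s t Y * X := by
  simp only [slice_apply, Finset.sum_mul, mul_assoc]
  refine Finset.sum_congr rfl fun u _ => ?_
  rw [hX _ (unit_mem A t u)]

theorem slice_toChain {A : Finset ℤ} (s t : A → Fin d) (X : Op d A) :
    slice A s t (toChain A X) = X s t • 1 := by
  rw [slice_apply, ← sum_unit A, Finset.smul_sum]
  refine Finset.sum_congr rfl fun u _ => ?_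
  simp only [unit]
  rw [← map_mul, ← map_mul, ← map_smul, ← mul_assoc, Matrix.single_mul_mul_single]
  simp [Matrix.smul_single]

theorem slice_mul_toChain {A : Finset ℤ} {X : Chain d}
    (hX : X ∈ Subalgebra.centralizer ℂ (localAlg d A : Set (Chain d))) (s t : A → Fin d)
    (Y : Op d A) : slice A s t (X * toChain A Y) = Y s t • X := by
  rw [slice_mul_left hX, slice_toChain, mul_smul_comm, mul_one]

theorem slice_mem {A B : Finset ℤ} (h : Disjoint A B) (s t : B → Fin d) {X : Chain d}
    (hX : X ∈ localAlg d (A ∪ B)) : slice B s t X ∈ localAlg d A := by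
  refine localAlg_union_induction h
    ((Subalgebra.toSubmodule (localAlg d A)).comap (slice B s t)) ?_ hX
  rintro X hX _ ⟨Y, rfl⟩
  change slice B s t (X * toChain B Y) ∈ localAlg d A
  rw [slice_mul_toChain (localAlg_le_centralizer h hX)]
  exact Subalgebra.smul_mem _ hX _

/-! ### Partial traces -/

/-- The normalized partial trace over the site `i`. -/
def siteTrace (d : ℕ) (i : ℤ) : Module.End ℂ (Chain d) :=
  (d : ℂ)⁻¹ • ∑ s, slice {i} s s

theorem siteTrace_apply (i : ℤ) (X : Chain d) :
    siteTrace d i X = (d : ℂ)⁻¹ • ∑ s, slice {i} s s X := by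
  simp [siteTrace]

theorem mem_centralizer_of_notMem {A : Finset ℤ} {i : ℤ} (hi : i ∉ A) {X : Chain d}
    (hX : X ∈ localAlg d A) :
    X ∈ Subalgebra.centralizer ℂ (localAlg d {i} : Set (Chain d)) :=
  localAlg_le_centralizer (Finset.disjoint_singleton_right.2 hi) hX

theorem siteTrace_mul_left {A : Finset ℤ} {i : ℤ} (hi : i ∉ A) {X : Chain d}
    (hX : X ∈ localAlg d A) (Y : Chain d) : siteTrace d i (X * Y) = X * siteTrace d i Y := by
  simp only [siteTrace_apply, slice_mul_left (mem_centralizer_of_notMem hi hX), mul_smul_comm,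
    Finset.mul_sum]

theorem siteTrace_mul_right {A : Finset ℤ} {i : ℤ} (hi : i ∉ A) {X : Chain d}
    (hX : X ∈ localAlg d A) (Y : Chain d) : siteTrace d i (Y * X) = siteTrace d i Y * X := by
  simp only [siteTrace_apply, slice_mul_right (mem_centralizer_of_notMem hi hX), smul_mul_assoc,
    Finset.sum_mul]

theorem siteTrace_lie {A : Finset ℤ} {i : ℤ} (hi : i ∉ A) {X : Chain d}
    (hX : X ∈ localAlg d A) (Y : Chain d) : siteTrace d i ⁅X, Y⁆ = ⁅X, siteTrace d i Y⁆ := by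
  rw [Ring.lie_def, Ring.lie_def, map_sub, siteTrace_mul_left hi hX, siteTrace_mul_right hi hX]

theorem siteTrace_of_mem_centralizer [NeZero d] {i : ℤ} {X : Chain d}
    (hX : X ∈ Subalgebra.centralizer ℂ (localAlg d {i} : Set (Chain d))) :
    siteTrace d i X = X := by
  have hd : (d : ℂ) ≠ 0 := Nat.cast_ne_zero.2 (NeZero.ne d)
  have h (s : ({i} : Finset ℤ) → Fin d) : slice {i} s s X = X := by
    simpa using slice_mul_toChain hX s s 1
  simp [siteTrace_apply, h, ← Nat.cast_smul_eq_nsmul ℂ, smul_smul, hd]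

theorem siteTrace_of_notMem [NeZero d] {A : Finset ℤ} {i : ℤ} (hi : i ∉ A) {X : Chain d}
    (hX : X ∈ localAlg d A) : siteTrace d i X = X :=
  siteTrace_of_mem_centralizer (mem_centralizer_of_notMem hi hX)

theorem erase_union_singleton_superset (A : Finset ℤ) (i : ℤ) :
    A ⊆ A.erase i ∪ {i} := fun j hj => by
  by_cases h : j = i <;> simp [h, hj]

theorem siteTrace_mem {A : Finset ℤ} (i : ℤ) {X : Chain d} (hX : X ∈ localAlg d A) :
    siteTrace d i X ∈ localAlg d (A.erase i) := by
  rw [siteTrace_apply]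
  exact Subalgebra.smul_mem _ (Subalgebra.sum_mem _ fun s _ => slice_mem (by simp) s s
    (localAlg_mono (erase_union_singleton_superset A i) hX)) _

theorem siteTrace_slice {A : Finset ℤ} {i : ℤ} (hi : i ∉ A) (s t : A → Fin d)
    (X : Chain d) : siteTrace d i (slice A s t X) = slice A s t (siteTrace d i X) := by
  simp only [slice_apply, map_sum, siteTrace_mul_left hi (unit_mem _ _ _),
    siteTrace_mul_right hi (unit_mem _ _ _)]

theorem siteTrace_comm (i j : ℤ) : Commute (siteTrace d i) (siteTrace d j) := by
  rcases eq_or_ne i j with rfl | h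
  · exact Commute.refl _
  · refine LinearMap.ext fun X => ?_
    have hi : i ∉ ({j} : Finset ℤ) := by simpa using h
    simp only [Module.End.mul_apply, siteTrace_apply j, map_smul, map_sum, siteTrace_slice hi]

theorem siteTrace_mul_comm {i : ℤ} {U : Chain d} (hU : U ∈ localAlg d {i}) (X : Chain d) :
    siteTrace d i (U * X) = siteTrace d i (X * U) := by
  obtain ⟨U, rfl⟩ := hU
  change siteTrace d i (toChain {i} U * X) = siteTrace d i (X * toChain {i} U)
  simp only [toChain_eq_sum_unit, Finset.sum_mul, Finset.mul_sum, map_sum, smul_mul_assoc,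
    mul_smul_comm, map_smul]
  refine Finset.sum_congr rfl fun a _ => Finset.sum_congr rfl fun b _ => congrArg _ ?_
  simp only [siteTrace_apply, slice_apply, ← mul_assoc, unit_mul_unit, ite_mul, zero_mul]
  simp only [mul_assoc, unit_mul_unit, mul_ite, mul_zero]
  rw [Finset.sum_comm, Finset.sum_comm (γ := ({i} : Finset ℤ) → Fin d)]
  simp

theorem siteTrace_lie_of_inter_subset {A B : Finset ℤ} {i : ℤ} (h : A ∩ B ⊆ {i}) {X Y : Chain d}
    (hX : X ∈ localAlg d A) (hY : Y ∈ localAlg d B) : siteTrace d i ⁅X, Y⁆ = 0 := by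
  suffices X ∈ LinearMap.ker (siteTrace d i ∘ₗ (LinearMap.mulRight ℂ Y - LinearMap.mulLeft ℂ Y)) by
    simpa [Ring.lie_def] using this
  refine localAlg_union_induction (by simp) _ (fun x hx u hu => ?_)
    (localAlg_mono (erase_union_singleton_superset A i) hX)
  have hxY : Commute x Y := commute_of_disjoint (Finset.disjoint_left.2 fun j hj hjB =>
    Finset.ne_of_mem_erase hj (Finset.mem_singleton.1
      (h (Finset.mem_inter.2 ⟨Finset.mem_of_mem_erase hj, hjB⟩)))) hx hY
  have hi : i ∉ A.erase i := Finset.notMem_erase i A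
  have key : siteTrace d i (x * u * Y) = siteTrace d i (Y * (x * u)) := by
    rw [mul_assoc, siteTrace_mul_left hi hx, siteTrace_mul_comm hu, ← siteTrace_mul_left hi hx,
      ← mul_assoc, ← mul_assoc, hxY.eq]
  simpa [sub_eq_zero] using key

theorem sum_eq_zero_of_sum_update_eq_zero {ι β M : Type*} [Fintype ι] [DecidableEq ι] [Fintype β]
    [AddCommMonoid M] (i : ι) (F : (ι → β) → M)
    (h : ∀ t, ∑ k, F (Function.update t i k) = 0) : ∑ t, F t = 0 := by
  rw [← (Equiv.funSplitAt i β).symm.sum_comp, Fintype.sum_prod_type_right]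
  refine Finset.sum_eq_zero fun r _ => ?_
  rcases isEmpty_or_nonempty β with hβ | ⟨⟨k₀⟩⟩
  · exact Finset.sum_of_isEmpty _
  · rw [← h ((Equiv.funSplitAt i β).symm (k₀, r))]
    refine Finset.sum_congr rfl fun k _ => congrArg F (funext fun j => ?_)
    by_cases hj : j = i
    · subst hj; simp
    · simp [hj]

theorem slice_singleton_apply {i : ℤ} (p : ({i} : Finset ℤ) → Fin d) (X : Chain d)
    (f : (ℤ → Fin d) → ℂ) (s : ℤ → Fin d) :
    slice {i} p p X f s = X (unit {i} p (siteRestrict {i} s) f) (glue s p) := by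
  simp [slice_apply, unit_apply]

theorem siteTrace_toChain_apply {A : Finset ℤ} {i : ℤ} (hi : i ∈ A) (X : Op d A)
    (f : (ℤ → Fin d) → ℂ) (s : ℤ → Fin d) :
    siteTrace d i (toChain A X) f s = (d : ℂ)⁻¹ * ∑ t,
      X (Function.update (siteRestrict A s) ⟨i, hi⟩ (t ⟨i, hi⟩)) t *
        f (glue s (Function.update t ⟨i, hi⟩ (s i))) := by
  have h₁ (t : A → Fin d) (p : ({i} : Finset ℤ) → Fin d) :
      siteRestrict {i} (glue (glue s p) t) = p ↔ (fun _ => t ⟨i, hi⟩) = p := by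
    simp only [funext_iff]
    refine forall_congr' fun ⟨j, hj⟩ => ?_
    obtain rfl := Finset.mem_singleton.1 hj
    simp [siteRestrict, glue, hi]
  have h₂ (t : A → Fin d) : siteRestrict A (glue s fun _ : ({i} : Finset ℤ) => t ⟨i, hi⟩) =
      Function.update (siteRestrict A s) ⟨i, hi⟩ (t ⟨i, hi⟩) := by
    funext j
    by_cases hj : j = ⟨i, hi⟩
    · subst hj; simp [siteRestrict, glue]
    · have : (j : ℤ) ≠ i := fun h => hj (Subtype.ext h)
      simp [siteRestrict, glue, hj, this]
  have h₃ (t : A → Fin d) :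
      glue (glue (glue s fun _ : ({i} : Finset ℤ) => t ⟨i, hi⟩) t) (siteRestrict {i} s) =
        glue s (Function.update t ⟨i, hi⟩ (s i)) := by
    funext j
    by_cases hj : j = i
    · subst hj; simp [siteRestrict, glue, hi]
    · by_cases hjA : j ∈ A <;> simp [glue, hj, hjA]
  simp only [siteTrace_apply, LinearMap.smul_apply, LinearMap.sum_apply, Pi.smul_apply,
    Finset.sum_apply, slice_singleton_apply, toChain_apply, unit_apply, h₁, smul_eq_mul]
  rw [Finset.sum_comm]
  simp only [mul_ite, mul_zero, Finset.sum_ite_eq, Finset.mem_univ, if_true, h₂, h₃]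

theorem siteTrace_toChain_of_mem {A : Finset ℤ} {X : Op d A} (hX : X ∈ Op₀ d A) {i : ℤ}
    (hi : i ∈ A) : siteTrace d i (toChain A X) = 0 := by
  refine LinearMap.ext fun f => funext fun s => ?_
  rw [siteTrace_toChain_apply hi, sum_eq_zero_of_sum_update_eq_zero ⟨i, hi⟩, mul_zero]
  · rfl
  · intro t
    simp only [Function.update_self, Function.update_idem, ← Finset.sum_mul]
    rw [hX ⟨i, hi⟩, zero_mul]

/-! ### The decomposition into traceless components -/

/-- A traceless operator on the sites `A` as an operator on the chain. -/
def termOp (A : Finset ℤ) : Op₀ d A →ₗ[ℂ] Chain d := (toChain A).toLinearMap ∘ₗ (Op₀ d A).subtype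

theorem termOp_mem (A : Finset ℤ) (X : Op₀ d A) : termOp A X ∈ localAlg d A := toChain_mem _ _

/-- The copy of `𝓑₀^{⊗A}` in the operators on the chain. -/
def traceless (d : ℕ) (A : Finset ℤ) : Submodule ℂ (Chain d) := LinearMap.range (termOp A)

theorem termOp_mem_traceless (A : Finset ℤ) (X : Op₀ d A) : termOp A X ∈ traceless d A := ⟨X, rfl⟩

theorem traceless_le_localAlg (A : Finset ℤ) :
    traceless d A ≤ Subalgebra.toSubmodule (localAlg d A) := by
  rintro _ ⟨X, rfl⟩
  exact termOp_mem A X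

theorem siteTrace_traceless {A : Finset ℤ} {i : ℤ} (hi : i ∈ A) {X : Chain d}
    (hX : X ∈ traceless d A) : siteTrace d i X = 0 := by
  obtain ⟨X, rfl⟩ := hX
  exact siteTrace_toChain_of_mem X.2 hi

theorem prod_restrict_eq_prod_ite {A B : Finset ℤ} (h : A ⊆ B) (f : B → ℂ) :
    ∏ i : A, f ⟨i, h i.2⟩ = ∏ i : B, if (i : ℤ) ∈ A then f i else 1 := by
  rw [← Finset.prod_filter]
  exact Finset.prod_bij (fun i _ => ⟨i, h i.2⟩) (fun i _ => by simp)
    (fun i _ j _ hij => Subtype.ext (Subtype.mk.inj hij))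
    (fun j hj => ⟨⟨j, (Finset.mem_filter.1 hj).2⟩, Finset.mem_univ _, rfl⟩) (fun i _ => rfl)

theorem sum_powerset_prod_ite (B : Finset ℤ) (f g : B → ℂ) :
    ∑ A ∈ B.powerset, ∏ i : B, (if (i : ℤ) ∈ A then f i else g i) = ∏ i, (f i + g i) := by
  rw [Finset.prod_add, Finset.powerset_univ]
  refine (Finset.sum_bij (fun S _ => S.map (Function.Embedding.subtype _)) (fun S _ => ?_)
    (fun S _ T _ h => Finset.map_injective _ h) (fun A hA => ?_) (fun S _ => ?_)).symm
  · exact Finset.mem_powerset.2 (Finset.map_subtype_subset S)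
  · exact ⟨A.subtype (· ∈ B), Finset.mem_univ _,
      Finset.subtype_map_of_mem (Finset.mem_powerset.1 hA)⟩
  · have : Finset.univ.filter (· ∈ S) = S := by ext; simp
    simp [Finset.prod_ite, Finset.sdiff_eq_filter, this, -Finset.univ_eq_attach]

theorem embed_componentOp {A B : Finset ℤ} (h : A ⊆ B) (Y : Op d B) (s t : B → Fin d) :
    embed h (componentOp h Y) s t = ∑ s', ∑ t', (∏ i : B, if (i : ℤ) ∈ A then
      tracelessKernel (s i) (t i) (s' i) (t' i) else
      (d : ℂ)⁻¹ * (if s i = t i ∧ s' i = t' i then 1 else 0)) * Y s' t' := by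
  by_cases hst : ∀ i : B, (i : ℤ) ∉ A → s i = t i
  · simp only [embed, if_pos hst, componentOp]
    refine Finset.sum_congr rfl fun s' _ => Finset.sum_congr rfl fun t' _ => congrArg (· * _) ?_
    refine (congrArg (· * _) (prod_restrict_eq_prod_ite h fun i =>
      tracelessKernel (s i) (t i) (s' i) (t' i))).trans ?_
    rw [← Finset.prod_mul_distrib]
    refine Finset.prod_congr rfl fun i _ => ?_
    by_cases hi : (i : ℤ) ∈ A
    · simp [hi]
    · simp [hi, hst i hi]
  · simp only [embed, if_neg hst]
    push Not at hst
    obtain ⟨i, hi, hsi⟩ := hst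
    symm
    refine Finset.sum_eq_zero fun s' _ => Finset.sum_eq_zero fun t' _ => ?_
    rw [Finset.prod_eq_zero (Finset.mem_univ i), zero_mul]
    simp [hi, hsi]

theorem sum_embed_component {B : Finset ℤ} (Y : Op d B) :
    ∑ A ∈ B.powerset.attach, embed (Finset.mem_powerset.1 A.2)
      (component (Finset.mem_powerset.1 A.2) Y : Op d A.1) = Y := by
  ext s t
  have kernel_sum (s' t' : B → Fin d) : ∑ A ∈ B.powerset, ∏ i : B, (if (i : ℤ) ∈ A then
      tracelessKernel (s i) (t i) (s' i) (t' i) else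
      (d : ℂ)⁻¹ * (if s i = t i ∧ s' i = t' i then 1 else 0)) =
      if s = s' ∧ t = t' then 1 else 0 := by
    rw [sum_powerset_prod_ite]
    simp only [tracelessKernel, sub_add_cancel, Finset.prod_ite_zero, Finset.mem_univ,
      true_imp_iff, forall_and, funext_iff, Finset.prod_const_one]
  rw [Matrix.sum_apply]
  simp only [component, embed_componentOp]
  rw [Finset.sum_comm]
  trans ∑ s', ∑ t', (if s = s' ∧ t = t' then 1 else 0) * Y s' t'
  · refine Finset.sum_congr rfl fun s' _ => ?_
    rw [Finset.sum_comm]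
    refine Finset.sum_congr rfl fun t' _ => ?_
    rw [← Finset.sum_mul, ← kernel_sum s' t', ← Finset.sum_attach B.powerset]
  · simp [ite_and]

theorem toChain_eq_sum_component {B : Finset ℤ} (Y : Op d B) :
    toChain B Y =
      ∑ A ∈ B.powerset.attach, termOp A.1 (component (Finset.mem_powerset.1 A.2) Y) := by
  conv_lhs => rw [← sum_embed_component Y]
  rw [map_sum]
  exact Finset.sum_congr rfl fun A _ => toChain_embed _ _

section Coeff

variable [NeZero d]

theorem termOp_injective (A : Finset ℤ) : Function.Injective (termOp (d := d) A) :=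
  fun _ _ h => Subtype.ext (toChain_injective A h)

theorem traceless_le_iInf_maxGenEigenspace (A : Finset ℤ) :
    traceless d A ≤ ⨅ i, (siteTrace d i).maxGenEigenspace (if i ∈ A then 0 else 1) := by
  refine fun X hX => Submodule.mem_iInf _ |>.2 fun i =>
    Module.End.eigenspace_le_maxGenEigenspace (Module.End.mem_eigenspace_iff.2 ?_)
  split_ifs with hi
  · rw [siteTrace_traceless hi hX, zero_smul]
  · rw [siteTrace_of_notMem hi (traceless_le_localAlg A hX), one_smul]

/- The traceless components are simultaneous eigenspaces of the commuting partial traces: on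
`𝓑₀^{⊗A}` the trace over `i` is `0` for `i ∈ A` and `1` for `i ∉ A`. -/
theorem iSupIndep_traceless : iSupIndep (traceless d) := by
  have h := (Module.End.independent_iInf_maxGenEigenspace_of_forall_mapsTo (siteTrace d)
    fun i j φ => Module.End.mapsTo_maxGenEigenspace_of_comm (siteTrace_comm j i) φ).comp
    (f := fun A : Finset ℤ => fun i => if i ∈ A then (0 : ℂ) else 1) fun A B hAB => by
      ext i
      have := congrFun hAB i
      by_cases hA : i ∈ A <;> by_cases hB : i ∈ B <;> simp_all
  exact h.mono traceless_le_iInf_maxGenEigenspace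

theorem exists_coeff (d : ℕ) [NeZero d] : ∃ π : Chain d →ₗ[ℂ] Π₀ A : Finset ℤ, Op₀ d A,
    ∀ (A : Finset ℤ) (X : Op₀ d A), π (termOp A X) = DFinsupp.single A X := by
  classical
  let f : (Π₀ A : Finset ℤ, Op₀ d A) →ₗ[ℂ] Chain d := DFinsupp.lsum ℂ fun A => termOp A
  let r (A : Finset ℤ) : Op₀ d A →ₗ[ℂ] traceless d A := (termOp A).rangeRestrict
  have hf : Function.Injective f := by
    have h : f = DFinsupp.lsum ℂ (fun A => (traceless d A).subtype) ∘ₗ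
        DFinsupp.mapRange.linearMap r :=
      DFinsupp.lhom_ext fun A X => by
        rw [LinearMap.comp_apply, DFinsupp.mapRange.linearMap_apply, DFinsupp.mapRange_single,
          DFinsupp.lsum_single, DFinsupp.lsum_single]
        rfl
    rw [h, LinearMap.coe_comp]
    refine iSupIndep_traceless.dfinsupp_lsum_injective.comp
      ((DFinsupp.mapRange_injective _ fun A => map_zero (r A)).2 fun A X Y hXY => ?_)
    exact termOp_injective A (congrArg Subtype.val hXY)
  obtain ⟨π, hπ⟩ := LinearMap.exists_leftInverse_of_injective (K := ℂ)
    (V := Π₀ A : Finset ℤ, Op₀ d A) (V' := Chain d) f (LinearMap.ker_eq_bot.2 hf)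
  refine ⟨π, fun A X => ?_⟩
  simpa [f] using LinearMap.congr_fun hπ (DFinsupp.single A X)

/-- The component on the sites `A` of an operator on the chain. It is meaningful on local operators
only: on the other operators it is an arbitrary linear extension. -/
def coeff (A : Finset ℤ) : Chain d →ₗ[ℂ] Op₀ d A :=
  DFinsupp.lapply A ∘ₗ (exists_coeff d).choose

theorem coeff_termOp_self (A : Finset ℤ) (X : Op₀ d A) : coeff A (termOp A X) = X := by
  rw [coeff, LinearMap.comp_apply, (exists_coeff d).choose_spec A X]
  simp

theorem coeff_termOp_of_ne {A B : Finset ℤ} (h : B ≠ A) (X : Op₀ d B) :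
    coeff A (termOp B X) = 0 := by
  rw [coeff, LinearMap.comp_apply, (exists_coeff d).choose_spec B X]
  exact DFinsupp.single_eq_of_ne h.symm

theorem coeff_toChain {A B : Finset ℤ} (h : A ⊆ B) (Y : Op d B) :
    coeff A (toChain B Y) = component h Y := by
  rw [toChain_eq_sum_component, map_sum,
    Finset.sum_eq_single_of_mem ⟨A, Finset.mem_powerset.2 h⟩ (Finset.mem_attach _ _)]
  · exact coeff_termOp_self _ _
  · intro C _ hC
    exact coeff_termOp_of_ne (fun h => hC (Subtype.ext h)) _

theorem eq_sum_coeff {B : Finset ℤ} {X : Chain d} (hX : X ∈ localAlg d B) :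
    X = ∑ A ∈ B.powerset, termOp A (coeff A X) := by
  obtain ⟨Y, rfl⟩ := hX
  change toChain B Y = ∑ A ∈ B.powerset, termOp A (coeff A (toChain B Y))
  conv_lhs => rw [toChain_eq_sum_component]
  rw [← Finset.sum_attach B.powerset]
  exact Finset.sum_congr rfl fun A _ => by rw [coeff_toChain (Finset.mem_powerset.1 A.2)]

theorem coeff_sum_termOp (S : Finset (Finset ℤ)) (x : ∀ A, Op₀ d A) (A : Finset ℤ) :
    coeff A (∑ C ∈ S, termOp C (x C)) = if A ∈ S then x A else 0 := by
  rw [map_sum]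
  split_ifs with h
  · rw [Finset.sum_eq_single_of_mem A h fun C _ hC => coeff_termOp_of_ne hC _, coeff_termOp_self]
  · exact Finset.sum_eq_zero fun C hC => coeff_termOp_of_ne (fun e : C = A => h (e ▸ hC)) _

theorem coeff_eq_zero {A B : Finset ℤ} {X : Chain d} (hX : X ∈ localAlg d B) (h : ¬ A ⊆ B) :
    coeff A X = 0 := by
  rw [eq_sum_coeff hX, coeff_sum_termOp, if_neg (by simpa using h)]

theorem termOp_coeff {A : Finset ℤ} {X : Chain d} (hX : X ∈ traceless d A) :
    termOp A (coeff A X) = X := by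
  obtain ⟨X, rfl⟩ := hX
  rw [coeff_termOp_self]

theorem coeff_of_mem_of_ne {A C : Finset ℤ} (h : A ≠ C) {X : Chain d}
    (hX : X ∈ traceless d A) : coeff C X = 0 := by
  obtain ⟨X, rfl⟩ := hX
  exact coeff_termOp_of_ne h X

theorem coeff_siteTrace_of_notMem {A B : Finset ℤ} {i : ℤ} (hi : i ∉ A) {X : Chain d}
    (hX : X ∈ localAlg d B) : coeff A (siteTrace d i X) = coeff A X := by
  have h (C : Finset ℤ) (x : Op₀ d C) : siteTrace d i (termOp C x) =
      termOp C (if i ∈ C then 0 else x) := by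
    split_ifs with hC
    · rw [map_zero, siteTrace_traceless hC (termOp_mem_traceless C x)]
    · exact siteTrace_of_notMem hC (termOp_mem C x)
  rw [eq_sum_coeff hX]
  simp only [map_sum, h]
  refine Finset.sum_congr rfl fun C _ => ?_
  rcases eq_or_ne C A with rfl | hC
  · rw [if_neg hi]
  · rw [coeff_termOp_of_ne hC, coeff_termOp_of_ne hC]

theorem mem_traceless {A : Finset ℤ} {X : Chain d} :
    X ∈ traceless d A ↔ X ∈ localAlg d A ∧ ∀ i ∈ A, siteTrace d i X = 0 := by
  refine ⟨fun h => ⟨traceless_le_localAlg A h, fun i hi => siteTrace_traceless hi h⟩, ?_⟩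
  rintro ⟨hX, h⟩
  rw [eq_sum_coeff hX, Finset.sum_eq_single_of_mem A (Finset.mem_powerset_self A)]
  · exact termOp_mem_traceless _ _
  · intro C hC hCA
    obtain ⟨i, hi, hiC⟩ := Finset.exists_of_ssubset
      ((Finset.mem_powerset.1 hC).ssubset_of_ne hCA)
    rw [← coeff_siteTrace_of_notMem hiC hX, h i hi, map_zero, map_zero]

theorem lie_mem_traceless {A B C : Finset ℤ} {i : ℤ} (hC : A ∪ B = C) (h : A ∩ B = {i})
    {X Y : Chain d} (hX : X ∈ traceless d A) (hY : Y ∈ traceless d B) :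
    ⁅X, Y⁆ ∈ traceless d C := by
  subst hC
  rw [mem_traceless] at hX hY ⊢
  refine ⟨lie_mem_localAlg (localAlg_mono Finset.subset_union_left hX.1)
    (localAlg_mono Finset.subset_union_right hY.1), fun j hj => ?_⟩
  by_cases hA : j ∈ A
  · by_cases hB : j ∈ B
    · obtain rfl : j = i := Finset.mem_singleton.1 (h ▸ Finset.mem_inter.2 ⟨hA, hB⟩)
      exact siteTrace_lie_of_inter_subset h.le hX.1 hY.1
    · rw [← lie_skew, map_neg, siteTrace_lie hB hY.1, hX.2 j hA, lie_zero, neg_zero]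
  · have hB : j ∈ B := (Finset.mem_union.1 hj).resolve_left hA
    rw [siteTrace_lie hA hX.1, hY.2 j hB, lie_zero]

end Coeff

/-! ### The Lie algebra of operators of finite range -/

/-- The term `Φ(A)` as an operator on the chain. -/
def term (A : Finset ℤ) : FormalOp d →ₗ[ℂ] Chain d := termOp A ∘ₗ LinearMap.proj A

/-- The restriction `Φ|_B` as an operator on the chain. -/
def truncate (B : Finset ℤ) : FormalOp d →ₗ[ℂ] Chain d := ∑ A ∈ B.powerset, term A

theorem truncate_apply (B : Finset ℤ) (Φ : FormalOp d) :
    truncate B Φ = ∑ A ∈ B.powerset, term A Φ := LinearMap.sum_apply _ _ _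

theorem term_mem (A : Finset ℤ) (Φ : FormalOp d) : term A Φ ∈ localAlg d A := termOp_mem _ _

theorem term_mem_traceless (A : Finset ℤ) (Φ : FormalOp d) : term A Φ ∈ traceless d A :=
  termOp_mem_traceless _ _

theorem toChain_restrict (Φ : FormalOp d) (B : Finset ℤ) :
    toChain B (restrict Φ B) = truncate B Φ := by
  rw [restrict, map_sum, truncate_apply, ← Finset.sum_attach B.powerset]
  exact Finset.sum_congr rfl fun A _ => toChain_embed _ _

theorem truncate_mem (B : Finset ℤ) (Φ : FormalOp d) : truncate B Φ ∈ localAlg d B :=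
  toChain_restrict Φ B ▸ toChain_mem _ _

/-- The operators which are at most `n`-local. -/
def atMostLocal (d n : ℕ) : Submodule ℂ (FormalOp d) where
  carrier := {Φ | AtMostLocal n Φ}
  zero_mem' _ hA := absurd rfl hA
  add_mem' {Φ Ψ} hΦ hΨ A hA := by
    by_cases h : Φ A = 0
    · exact hΨ A fun h' => hA (by rw [Pi.add_apply, h, h', add_zero])
    · exact hΦ A h
  smul_mem' c Φ hΦ A hA := hΦ A fun h => hA (by rw [Pi.smul_apply, h, smul_zero])

theorem atMostLocal_mono : Monotone (atMostLocal d) := by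
  intro m n hmn Φ hΦ A hA
  obtain ⟨i, hi⟩ := hΦ A hA
  exact ⟨i, hi.trans (Finset.Ico_subset_Ico_right (by omega))⟩

/-- The operators of finite range. -/
def finiteRange (d : ℕ) : Submodule ℂ (FormalOp d) := ⨆ n, atMostLocal d n

theorem mem_finiteRange {Φ : FormalOp d} : Φ ∈ finiteRange d ↔ ∃ n, AtMostLocal n Φ :=
  Submodule.mem_iSup_of_directed _ atMostLocal_mono.directed_le

theorem AtMostLocal.mem_finiteRange {n : ℕ} {Φ : FormalOp d} (h : AtMostLocal n Φ) :
    Φ ∈ finiteRange d := SpinChain.mem_finiteRange.2 ⟨n, h⟩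

theorem finite_setOf_subset_Ico (n : ℕ) (A : Finset ℤ) :
    {C : Finset ℤ | ¬ Disjoint C A ∧ ∃ i : ℤ, C ⊆ Finset.Ico i (i + n)}.Finite := by
  refine (A.biUnion fun x => Finset.Icc (x - n) (x + n)).powerset.finite_toSet.subset ?_
  rintro C ⟨hCA, i, hi⟩
  obtain ⟨x, hx, hx'⟩ := Finset.not_disjoint_iff.1 hCA
  refine Finset.mem_coe.2 (Finset.mem_powerset.2 fun y hy => Finset.mem_biUnion.2 ⟨x, hx', ?_⟩)
  have h₁ := Finset.mem_Ico.1 (hi hx)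
  have h₂ := Finset.mem_Ico.1 (hi hy)
  rw [Finset.mem_Icc]
  omega

theorem exists_union_subset_Ico {m n k : ℕ} (hk : m + n ≤ k + 1) {C D : Finset ℤ}
    (hC : ∃ i : ℤ, C ⊆ Finset.Ico i (i + m)) (hD : ∃ i : ℤ, D ⊆ Finset.Ico i (i + n))
    (h : ¬ Disjoint C D) : ∃ i : ℤ, C ∪ D ⊆ Finset.Ico i (i + k) := by
  obtain ⟨i, hi⟩ := hC
  obtain ⟨j, hj⟩ := hD
  obtain ⟨x, hx, hx'⟩ := Finset.not_disjoint_iff.1 h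
  have h₁ := Finset.mem_Ico.1 (hi hx)
  have h₂ := Finset.mem_Ico.1 (hj hx')
  refine ⟨min i j, Finset.union_subset (hi.trans ?_) (hj.trans ?_)⟩ <;>
    exact Finset.Ico_subset_Ico (by omega) (by omega)

theorem eventually_sum_eq_finsum {ι M : Type*} [AddCommMonoid M] {f : ι → M}
    (hf : (Function.support f).Finite) : ∀ᶠ S : Finset ι in atTop, ∑ i ∈ S, f i = ∑ᶠ i, f i := by
  filter_upwards [eventually_ge_atTop hf.toFinset] with S hS
  exact (finsum_eq_sum_of_support_subset f fun i hi => hS (hf.mem_toFinset.2 hi)).symm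

theorem tendsto_powerset_product_powerset {α : Type*} :
    Tendsto (fun B : Finset α => B.powerset ×ˢ B.powerset) atTop atTop := by
  classical
  refine tendsto_atTop.2 fun S => ?_
  filter_upwards [(Finset.eventually_all S).2 fun p _ => eventually_ge_atTop (p.1 ∪ p.2)]
    with B hB p hp
  rw [Finset.mem_product, Finset.mem_powerset, Finset.mem_powerset]
  exact Finset.union_subset_iff.1 (hB p hp)

theorem componentOp_empty {B : Finset ℤ} (h : ∅ ⊆ B) (Y : Op d B)
    (s t : (∅ : Finset ℤ) → Fin d) :
    componentOp h Y s t = (d : ℂ)⁻¹ ^ B.card * Y.trace := by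
  simp only [componentOp, Finset.notMem_empty, if_false, Finset.univ_eq_empty, Finset.prod_empty,
    one_mul, Matrix.trace, Matrix.diag, Finset.mul_sum, Finset.prod_mul_distrib,
    Finset.prod_const, Finset.card_univ, Fintype.card_coe, Finset.prod_ite_zero]
  refine Finset.sum_congr rfl fun s' _ => ?_
  rw [Finset.sum_eq_single s']
  · simp
  · intro t' _ ht
    rw [if_neg, mul_zero, zero_mul]
    intro h
    exact ht (funext fun i => (h i (Finset.mem_univ i)).symm)
  · simp

section Comm

variable [NeZero d]

theorem term_eq_zero_iff {A : Finset ℤ} {Φ : FormalOp d} : term A Φ = 0 ↔ Φ A = 0 :=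
  map_eq_zero_iff _ (termOp_injective A)

theorem formalOp_ext {Φ Ψ : FormalOp d} (h : ∀ A, term A Φ = term A Ψ) : Φ = Ψ :=
  funext fun A => termOp_injective A (h A)

theorem coeff_truncate {A B : Finset ℤ} (h : A ⊆ B) (Φ : FormalOp d) :
    coeff A (truncate B Φ) = Φ A := by
  rw [truncate_apply]
  exact (coeff_sum_termOp _ Φ A).trans (if_pos (Finset.mem_powerset.2 h))

theorem coeff_empty_lie {B : Finset ℤ} {X Y : Chain d} (hX : X ∈ localAlg d B)
    (hY : Y ∈ localAlg d B) : coeff ∅ ⁅X, Y⁆ = 0 := by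
  obtain ⟨X, rfl⟩ := hX
  obtain ⟨Y, rfl⟩ := hY
  change coeff ∅ ⁅toChain B X, toChain B Y⁆ = 0
  rw [Ring.lie_def, ← map_mul, ← map_mul, ← map_sub, coeff_toChain (Finset.empty_subset B)]
  ext s t
  simp [component, componentOp_empty, Matrix.trace_mul_comm X Y]

theorem coeff_lie_term_ne_zero {Φ Ψ : FormalOp d} {A C D : Finset ℤ}
    (h : coeff A ⁅term C Φ, term D Ψ⁆ ≠ 0) :
    Φ C ≠ 0 ∧ Ψ D ≠ 0 ∧ ¬ Disjoint C D ∧ A.Nonempty ∧ A ⊆ C ∪ D := by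
  have hC := localAlg_mono (Finset.subset_union_left (s₂ := D)) (term_mem C Φ)
  have hD := localAlg_mono (Finset.subset_union_right (s₁ := C)) (term_mem D Ψ)
  refine ⟨fun e => h ?_, fun e => h ?_, fun e => h ?_, Finset.nonempty_iff_ne_empty.2 fun e => h ?_,
    not_imp_comm.1 (coeff_eq_zero (lie_mem_localAlg hC hD)) h⟩
  · rw [term_eq_zero_iff.2 e, zero_lie, map_zero]
  · rw [term_eq_zero_iff.2 e, lie_zero, map_zero]
  · rw [lie_eq_zero_of_disjoint e (term_mem C Φ) (term_mem D Ψ), map_zero]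
  · rw [e, coeff_empty_lie hC hD]

theorem finite_support_coeff_lie_term {Φ Ψ : FormalOp d} (hΦ : Φ ∈ finiteRange d)
    (hΨ : Ψ ∈ finiteRange d) (A : Finset ℤ) :
    (Function.support fun p : Finset ℤ × Finset ℤ => coeff A ⁅term p.1 Φ, term p.2 Ψ⁆).Finite := by
  obtain ⟨m, hm⟩ := mem_finiteRange.1 hΦ
  obtain ⟨n, hn⟩ := mem_finiteRange.1 hΨ
  refine ((finite_setOf_subset_Ico (m + n) A).biUnion fun E _ =>
    (E.powerset ×ˢ E.powerset).finite_toSet).subset fun p hp => ?_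
  obtain ⟨hC, hD, hCD, hA, hAp⟩ := coeff_lie_term_ne_zero hp
  refine Set.mem_biUnion (x := p.1 ∪ p.2) ⟨fun h => hA.ne_empty ?_,
    exists_union_subset_Ico (Nat.le_succ _) (hm _ hC) (hn _ hD) hCD⟩ ?_
  · exact Finset.disjoint_self_iff_empty A |>.1 (h.mono_left hAp)
  · exact Finset.mem_coe.2 (Finset.mem_product.2 ⟨Finset.mem_powerset.2 Finset.subset_union_left,
      Finset.mem_powerset.2 Finset.subset_union_right⟩)

theorem component_commutator {A B : Finset ℤ} (h : A ⊆ B) (Φ Ψ : FormalOp d) :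
    component h (restrict Φ B * restrict Ψ B - restrict Ψ B * restrict Φ B) =
      coeff A ⁅truncate B Φ, truncate B Ψ⁆ := by
  rw [← coeff_toChain h, map_sub, map_mul, map_mul, toChain_restrict, toChain_restrict,
    Ring.lie_def]

theorem coeff_lie_truncate (Φ Ψ : FormalOp d) (A B : Finset ℤ) :
    coeff A ⁅truncate B Φ, truncate B Ψ⁆ =
      ∑ p ∈ B.powerset ×ˢ B.powerset, coeff A ⁅term p.1 Φ, term p.2 Ψ⁆ := by
  rw [truncate_apply, truncate_apply, sum_lie_sum, map_sum, Finset.sum_product]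
  exact Finset.sum_congr rfl fun C _ => map_sum _ _ _

theorem eventually_coeff_lie_truncate_eq_finsum {Φ Ψ : FormalOp d} (hΦ : Φ ∈ finiteRange d)
    (hΨ : Ψ ∈ finiteRange d) (A : Finset ℤ) :
    ∀ᶠ B : Finset ℤ in atTop, coeff A ⁅truncate B Φ, truncate B Ψ⁆ =
      ∑ᶠ p : Finset ℤ × Finset ℤ, coeff A ⁅term p.1 Φ, term p.2 Ψ⁆ := by
  simp only [coeff_lie_truncate]
  exact tendsto_powerset_product_powerset.eventually
    (eventually_sum_eq_finsum (finite_support_coeff_lie_term hΦ hΨ A))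

theorem opComm_eq_finsum {Φ Ψ : FormalOp d} (hΦ : Φ ∈ finiteRange d)
    (hΨ : Ψ ∈ finiteRange d) (A : Finset ℤ) :
    opComm Φ Ψ A =
      ∑ᶠ p : Finset ℤ × Finset ℤ, coeff A ⁅term p.1 Φ, term p.2 Ψ⁆ := by
  have h : ∃ X : Op₀ d A, ∀ᶠ B : Finset ℤ in atTop, ∀ hAB : A ⊆ B, component hAB
      (restrict Φ B * restrict Ψ B - restrict Ψ B * restrict Φ B) = X :=
    ⟨_, (eventually_coeff_lie_truncate_eq_finsum hΦ hΨ A).mono fun B hB hAB =>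
      (component_commutator hAB _ _).trans hB⟩
  rw [opComm, dif_pos h]
  obtain ⟨B, ⟨h₁, h₂⟩, hAB⟩ := ((h.choose_spec.and
    (eventually_coeff_lie_truncate_eq_finsum hΦ hΨ A)).and (eventually_ge_atTop A)).exists
  exact (h₁ hAB).symm.trans ((component_commutator hAB _ _).trans h₂)

theorem eventually_coeff_lie {Φ Ψ : FormalOp d} (hΦ : Φ ∈ finiteRange d)
    (hΨ : Ψ ∈ finiteRange d) (A : Finset ℤ) : ∀ᶠ B : Finset ℤ in atTop,
    coeff A ⁅truncate B Φ, truncate B Ψ⁆ = opComm Φ Ψ A := by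
  rw [opComm_eq_finsum hΦ hΨ]
  exact eventually_coeff_lie_truncate_eq_finsum hΦ hΨ A

end Comm

/-! ### The derivation of an operator of finite range -/

/-- The operators on the chain which act on finitely many sites. -/
def localOps (d : ℕ) : Subalgebra ℂ (Chain d) := ⨆ A, localAlg d A

theorem mem_localOps {X : Chain d} : X ∈ localOps d ↔ ∃ A, X ∈ localAlg d A := by
  have h : Monotone (localAlg d) := fun _ _ => localAlg_mono
  rw [localOps, ← SetLike.mem_coe, Subalgebra.coe_iSup_of_directed h.directed_le, Set.mem_iUnion]
  rfl

theorem support_lie_term_subset {n : ℕ} {Φ : FormalOp d} (hΦ : AtMostLocal n Φ)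
    {A : Finset ℤ} {X : Chain d} (hX : X ∈ localAlg d A) :
    (Function.support fun C => ⁅term C Φ, X⁆) ⊆
      {C | ¬ Disjoint C A ∧ ∃ i : ℤ, C ⊆ Finset.Ico i (i + n)} := by
  refine fun C hC => ⟨fun h => hC ?_, hΦ C fun h => hC ?_⟩
  · exact lie_eq_zero_of_disjoint h (term_mem C Φ) hX
  · change ⁅termOp C (Φ C), X⁆ = 0
    rw [h, map_zero, zero_lie]

theorem finite_support_lie_term {Φ : FormalOp d} (hΦ : Φ ∈ finiteRange d) {X : Chain d}
    (hX : X ∈ localOps d) : (Function.support fun C => ⁅term C Φ, X⁆).Finite := by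
  obtain ⟨n, hn⟩ := mem_finiteRange.1 hΦ
  obtain ⟨A, hA⟩ := mem_localOps.1 hX
  exact (finite_setOf_subset_Ico n A).subset (support_lie_term_subset hn hA)

/-- The derivation `X ↦ [Φ, X]` of an operator `Φ` of finite range, on the operators `X` which act
on finitely many sites. -/
def formalLie (Φ : FormalOp d) (X : Chain d) : Chain d := ∑ᶠ C, ⁅term C Φ, X⁆

theorem eventually_forall_lie_truncate {Φ : FormalOp d} (hΦ : Φ ∈ finiteRange d)
    (A : Finset ℤ) : ∀ᶠ B : Finset ℤ in atTop, ∀ X ∈ localAlg d A,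
      ⁅truncate B Φ, X⁆ = formalLie Φ X := by
  obtain ⟨n, hn⟩ := mem_finiteRange.1 hΦ
  filter_upwards [tendsto_finset_powerset_atTop_atTop.eventually
    (eventually_ge_atTop (finite_setOf_subset_Ico n A).toFinset)] with B hB X hX
  rw [truncate_apply, sum_lie]
  refine (finsum_eq_sum_of_support_subset _ fun C hC => hB ?_).symm
  exact Set.Finite.mem_toFinset _ |>.2 (support_lie_term_subset hn hX hC)

theorem eventually_lie_truncate {Φ : FormalOp d} (hΦ : Φ ∈ finiteRange d) {X : Chain d}
    (hX : X ∈ localOps d) : ∀ᶠ B : Finset ℤ in atTop, ⁅truncate B Φ, X⁆ = formalLie Φ X := by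
  obtain ⟨A, hA⟩ := mem_localOps.1 hX
  exact (eventually_forall_lie_truncate hΦ A).mono fun B hB => hB X hA

theorem formalLie_mem {Φ : FormalOp d} (hΦ : Φ ∈ finiteRange d) {X : Chain d}
    (hX : X ∈ localOps d) : formalLie Φ X ∈ localOps d := by
  obtain ⟨A, hA⟩ := mem_localOps.1 hX
  obtain ⟨B, hB, hAB⟩ := ((eventually_lie_truncate hΦ hX).and (eventually_ge_atTop A)).exists
  exact mem_localOps.2 ⟨B, hB ▸ lie_mem_localAlg (truncate_mem B Φ) (localAlg_mono hAB hA)⟩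

theorem formalLie_sub {Φ : FormalOp d} (hΦ : Φ ∈ finiteRange d) {X Y : Chain d}
    (hX : X ∈ localOps d) (hY : Y ∈ localOps d) :
    formalLie Φ (X - Y) = formalLie Φ X - formalLie Φ Y := by
  simp only [formalLie, lie_sub]
  exact finsum_sub_distrib (finite_support_lie_term hΦ hX) (finite_support_lie_term hΦ hY)

theorem add_formalLie {Φ Ψ : FormalOp d} (hΦ : Φ ∈ finiteRange d) (hΨ : Ψ ∈ finiteRange d)
    {X : Chain d} (hX : X ∈ localOps d) :
    formalLie (Φ + Ψ) X = formalLie Φ X + formalLie Ψ X := by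
  simp only [formalLie, map_add, add_lie]
  exact finsum_add_distrib (finite_support_lie_term hΦ hX) (finite_support_lie_term hΨ hX)

section LieAlgebra

variable [NeZero d]

theorem coeff_lie_truncate_ne_zero {m n k : ℕ} (hk : m + n ≤ k + 1) {Φ Ψ : FormalOp d}
    (hΦ : AtMostLocal m Φ) (hΨ : AtMostLocal n Ψ) {A B : Finset ℤ}
    (h : coeff A ⁅truncate B Φ, truncate B Ψ⁆ ≠ 0) :
    A.Nonempty ∧ ∃ i : ℤ, A ⊆ Finset.Ico i (i + k) := by
  rw [coeff_lie_truncate] at h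
  obtain ⟨p, _, hp⟩ := Finset.exists_ne_zero_of_sum_ne_zero h
  obtain ⟨hC, hD, hCD, hA, hAp⟩ := coeff_lie_term_ne_zero hp
  obtain ⟨i, hi⟩ := exists_union_subset_Ico hk (hΦ _ hC) (hΨ _ hD) hCD
  exact ⟨hA, i, hAp.trans hi⟩

theorem AtMostLocal.opComm {m n k : ℕ} (hk : m + n ≤ k + 1) {Φ Ψ : FormalOp d}
    (hΦ : AtMostLocal m Φ) (hΨ : AtMostLocal n Ψ) : AtMostLocal k (opComm Φ Ψ) := by
  intro A hA
  obtain ⟨B, hB⟩ := (eventually_coeff_lie hΦ.mem_finiteRange hΨ.mem_finiteRange A).exists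
  exact (coeff_lie_truncate_ne_zero hk hΦ hΨ (hB.symm ▸ hA)).2

theorem opComm_mem_finiteRange {Φ Ψ : FormalOp d} (hΦ : Φ ∈ finiteRange d)
    (hΨ : Ψ ∈ finiteRange d) : opComm Φ Ψ ∈ finiteRange d := by
  obtain ⟨m, hm⟩ := mem_finiteRange.1 hΦ
  obtain ⟨n, hn⟩ := mem_finiteRange.1 hΨ
  exact (hm.opComm (Nat.le_succ _) hn).mem_finiteRange

theorem opComm_empty {Φ Ψ : FormalOp d} (hΦ : Φ ∈ finiteRange d) (hΨ : Ψ ∈ finiteRange d) :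
    opComm Φ Ψ ∅ = 0 := by
  obtain ⟨B, hB⟩ := (eventually_coeff_lie hΦ hΨ ∅).exists
  rw [← hB, coeff_empty_lie (truncate_mem B Φ) (truncate_mem B Ψ)]

theorem eventually_lie_truncate_opComm {Φ Ψ : FormalOp d} (hΦ : Φ ∈ finiteRange d)
    (hΨ : Ψ ∈ finiteRange d) {X : Chain d} (hX : X ∈ localOps d) :
    ∀ᶠ B : Finset ℤ in atTop,
      ⁅truncate B (opComm Φ Ψ), X⁆ = ⁅⁅truncate B Φ, truncate B Ψ⁆, X⁆ := by
  obtain ⟨m, hm⟩ := mem_finiteRange.1 hΦ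
  obtain ⟨n, hn⟩ := mem_finiteRange.1 hΨ
  obtain ⟨A, hA⟩ := mem_localOps.1 hX
  have hk : m + n ≤ m + n + 1 := Nat.le_succ _
  filter_upwards [(finite_setOf_subset_Ico (m + n) A).eventually_all.2
    fun C _ => eventually_coeff_lie hΦ hΨ C] with B hB
  rw [eq_sum_coeff (lie_mem_localAlg (truncate_mem B Φ) (truncate_mem B Ψ)), truncate_apply,
    sum_lie, sum_lie]
  refine Finset.sum_congr rfl fun C _ => ?_
  change ⁅termOp C (opComm Φ Ψ C), X⁆ = _
  by_cases hd : Disjoint C A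
  · rw [lie_eq_zero_of_disjoint hd (termOp_mem _ _) hA,
      lie_eq_zero_of_disjoint hd (termOp_mem _ _) hA]
  by_cases hC : ∃ i : ℤ, C ⊆ Finset.Ico i (i + (m + n : ℕ))
  · rw [hB C ⟨hd, hC⟩]
  · rw [not_imp_comm.1 (hm.opComm hk hn C) hC,
      not_imp_comm.1 (fun h => (coeff_lie_truncate_ne_zero hk hm hn h).2) hC]

theorem opComm_formalLie {Φ Ψ : FormalOp d} (hΦ : Φ ∈ finiteRange d) (hΨ : Ψ ∈ finiteRange d)
    {X : Chain d} (hX : X ∈ localOps d) : formalLie (opComm Φ Ψ) X =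
      formalLie Φ (formalLie Ψ X) - formalLie Ψ (formalLie Φ X) := by
  obtain ⟨B, hB⟩ := (eventually_lie_truncate_opComm hΦ hΨ hX |>.and <|
    eventually_lie_truncate (opComm_mem_finiteRange hΦ hΨ) hX |>.and <|
    eventually_lie_truncate hΦ hX |>.and <| eventually_lie_truncate hΨ hX |>.and <|
    eventually_lie_truncate hΦ (formalLie_mem hΨ hX) |>.and <|
    eventually_lie_truncate hΨ (formalLie_mem hΦ hX)).exists
  obtain ⟨h, hΦΨ, hΦX, hΨX, hΦΨX, hΨΦX⟩ := hB
  rw [← hΦΨ, h, lie_lie, hΨX, hΦX, hΦΨX, hΨΦX]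

theorem eq_of_formalLie_eq {Φ Ψ : FormalOp d} (hΦ : Φ ∈ finiteRange d) (hΨ : Ψ ∈ finiteRange d)
    (h : ∀ X ∈ localOps d, formalLie Φ X = formalLie Ψ X) {A : Finset ℤ} (hA : A.Nonempty) :
    Φ A = Ψ A := by
  obtain ⟨i, hi⟩ := hA
  obtain ⟨B, hΦB, hΨB, hAB⟩ := (eventually_forall_lie_truncate hΦ {i} |>.and <|
    eventually_forall_lie_truncate hΨ {i} |>.and <| eventually_ge_atTop A).exists
  have hcomm : truncate B (Φ - Ψ) ∈
      Subalgebra.centralizer ℂ (localAlg d {i} : Set (Chain d)) := by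
    rw [Subalgebra.mem_centralizer_iff]
    intro U hU
    have : ⁅truncate B (Φ - Ψ), U⁆ = 0 := by
      rw [map_sub, sub_lie, hΦB U hU, hΨB U hU, h U (mem_localOps.2 ⟨_, hU⟩), sub_self]
    exact (sub_eq_zero.1 this).symm
  have hmem := siteTrace_mem i (truncate_mem B (Φ - Ψ))
  rw [siteTrace_of_mem_centralizer hcomm] at hmem
  have hzero := coeff_eq_zero hmem fun hA => Finset.notMem_erase i B (hA hi)
  rw [coeff_truncate hAB] at hzero
  exact sub_eq_zero.1 hzero

theorem opComm_opComm {Φ Ψ Θ : FormalOp d} (hΦ : Φ ∈ finiteRange d) (hΨ : Ψ ∈ finiteRange d)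
    (hΘ : Θ ∈ finiteRange d) :
    opComm Φ (opComm Ψ Θ) = opComm (opComm Φ Ψ) Θ + opComm Ψ (opComm Φ Θ) := by
  have hΦΨ := opComm_mem_finiteRange hΦ hΨ
  have hΦΘ := opComm_mem_finiteRange hΦ hΘ
  have hΨΘ := opComm_mem_finiteRange hΨ hΘ
  have h₁ := opComm_mem_finiteRange hΦ hΨΘ
  have h₂ := opComm_mem_finiteRange hΦΨ hΘ
  have h₃ := opComm_mem_finiteRange hΨ hΦΘ
  funext A
  rcases A.eq_empty_or_nonempty with rfl | hA
  · rw [Pi.add_apply, opComm_empty hΦ hΨΘ, opComm_empty hΦΨ hΘ, opComm_empty hΨ hΦΘ, add_zero]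
  refine eq_of_formalLie_eq h₁ (add_mem h₂ h₃) (fun X hX => ?_) hA
  have hΦX := formalLie_mem hΦ hX
  have hΨX := formalLie_mem hΨ hX
  have hΘX := formalLie_mem hΘ hX
  rw [add_formalLie h₂ h₃ hX, opComm_formalLie hΦ hΨΘ hX, opComm_formalLie hΦΨ hΘ hX,
    opComm_formalLie hΨ hΦΘ hX, opComm_formalLie hΨ hΘ hX, opComm_formalLie hΦ hΘ hX,
    opComm_formalLie hΨ hΘ hΦX, opComm_formalLie hΦ hΨ hΘX, opComm_formalLie hΦ hΨ hX,
    opComm_formalLie hΦ hΘ hΨX, formalLie_sub hΦ (formalLie_mem hΨ hΘX) (formalLie_mem hΘ hΨX),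
    formalLie_sub hΘ (formalLie_mem hΦ hΨX) (formalLie_mem hΨ hΦX),
    formalLie_sub hΨ (formalLie_mem hΦ hΘX) (formalLie_mem hΘ hΦX)]
  abel

theorem opComm_add {Φ Ψ Θ : FormalOp d} (hΦ : Φ ∈ finiteRange d) (hΨ : Ψ ∈ finiteRange d)
    (hΘ : Θ ∈ finiteRange d) : opComm Φ (Ψ + Θ) = opComm Φ Ψ + opComm Φ Θ := by
  funext A
  obtain ⟨B, h₁, h₂, h₃⟩ := (eventually_coeff_lie hΦ hΨ A |>.and <|
    eventually_coeff_lie hΦ hΘ A |>.and <| eventually_coeff_lie hΦ (add_mem hΨ hΘ) A).exists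
  rw [Pi.add_apply, ← h₁, ← h₂, ← h₃, map_add, lie_add, map_add]

theorem opComm_smul (c : ℂ) {Φ Ψ : FormalOp d} (hΦ : Φ ∈ finiteRange d)
    (hΨ : Ψ ∈ finiteRange d) : opComm Φ (c • Ψ) = c • opComm Φ Ψ := by
  funext A
  obtain ⟨B, h₁, h₂⟩ := ((eventually_coeff_lie hΦ hΨ A).and
    (eventually_coeff_lie hΦ (Submodule.smul_mem _ c hΨ) A)).exists
  rw [Pi.smul_apply, ← h₁, ← h₂, map_smul, lie_smul, map_smul]

theorem add_opComm {Φ Ψ Θ : FormalOp d} (hΦ : Φ ∈ finiteRange d) (hΨ : Ψ ∈ finiteRange d)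
    (hΘ : Θ ∈ finiteRange d) : opComm (Φ + Ψ) Θ = opComm Φ Θ + opComm Ψ Θ := by
  funext A
  obtain ⟨B, h₁, h₂, h₃⟩ := (eventually_coeff_lie hΦ hΘ A |>.and <|
    eventually_coeff_lie hΨ hΘ A |>.and <| eventually_coeff_lie (add_mem hΦ hΨ) hΘ A).exists
  rw [Pi.add_apply, ← h₁, ← h₂, ← h₃, map_add, add_lie, map_add]

theorem opComm_self {Φ : FormalOp d} (hΦ : Φ ∈ finiteRange d) : opComm Φ Φ = 0 := by
  funext A
  obtain ⟨B, h⟩ := (eventually_coeff_lie hΦ hΦ A).exists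
  rw [Pi.zero_apply, ← h, lie_self, map_zero]

instance : Bracket (finiteRange d) (finiteRange d) where
  bracket Φ Ψ := ⟨opComm Φ Ψ, opComm_mem_finiteRange Φ.2 Ψ.2⟩

instance : LieRing (finiteRange d) where
  add_lie Φ Ψ Θ := Subtype.ext (add_opComm Φ.2 Ψ.2 Θ.2)
  lie_add Φ Ψ Θ := Subtype.ext (opComm_add Φ.2 Ψ.2 Θ.2)
  lie_self Φ := Subtype.ext (opComm_self Φ.2)
  leibniz_lie Φ Ψ Θ := Subtype.ext (opComm_opComm Φ.2 Ψ.2 Θ.2)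

instance : LieAlgebra ℂ (finiteRange d) where
  lie_smul c Φ Ψ := Subtype.ext (opComm_smul c Φ.2 Ψ.2)

end LieAlgebra

/-! ### Translations -/

/-- The shift of the configurations of the chain by one site. -/
def shiftEquiv (d : ℕ) : (ℤ → Fin d) ≃ (ℤ → Fin d) := (Equiv.addRight 1).arrowCongr (Equiv.refl _)

/-- The translation of the operators on the chain, which moves an operator on `A + 1` to `A`. -/
def translateChain (d : ℕ) : Chain d ≃ₐ[ℂ] Chain d :=
  (LinearEquiv.funCongrLeft ℂ ℂ (shiftEquiv d)).conjAlgEquiv ℂ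

theorem translateChain_apply (X : Chain d) (f : (ℤ → Fin d) → ℂ) (s : ℤ → Fin d) :
    translateChain d X f s = X (f ∘ (shiftEquiv d).symm) (shiftEquiv d s) := rfl

theorem mem_shift {A : Finset ℤ} {j : ℤ} : j ∈ shift A ↔ j - 1 ∈ A :=
  Finset.mem_map_equiv (f := Equiv.addRight 1)

/-- The shift `A ↦ A + 1` as an order isomorphism. -/
def shiftIso : Finset ℤ ≃o Finset ℤ where
  toEquiv := (Equiv.addRight 1).finsetCongr
  map_rel_iff' := Finset.map_subset_map

theorem shift_subset_shift {A B : Finset ℤ} : shift A ⊆ shift B ↔ A ⊆ B := shiftIso.le_iff_le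

/-- The bijection between the configurations on `A` and on `A + 1`. -/
def shiftConfigEquiv (A : Finset ℤ) : (A → Fin d) ≃ (shift A → Fin d) where
  toFun := shiftConfig
  invFun t := fun i => t ⟨i + 1, mem_shift.2 (by simp)⟩
  left_inv s := by
    funext i
    simp [shiftConfig]
  right_inv t := by
    funext i
    simp [shiftConfig]

theorem translateChain_toChain (A : Finset ℤ) (Y : Op d (shift A)) :
    translateChain d (toChain (shift A) Y) = toChain A (Y.submatrix shiftConfig shiftConfig) := by
  refine LinearMap.ext fun f => funext fun s => ?_
  rw [translateChain_apply, toChain_apply, toChain_apply]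
  refine (Fintype.sum_equiv (shiftConfigEquiv A) _ _ fun t => ?_).symm
  have h : (shiftEquiv d).symm (glue (shiftEquiv d s) (shiftConfigEquiv A t)) = glue s t := by
    rw [Equiv.symm_apply_eq]
    funext j
    by_cases hj : j - 1 ∈ A <;>
      simp [glue, shiftEquiv, shiftConfigEquiv, shiftConfig, mem_shift, ← sub_eq_add_neg, hj]
  rw [Function.comp_apply, h]
  rfl

theorem term_translateOp (A : Finset ℤ) (Φ : FormalOp d) :
    term A (translateOp Φ) = translateChain d (term (shift A) Φ) :=
  (translateChain_toChain A _).symm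

theorem sum_powerset_shift {M : Type*} [AddCommMonoid M] (f : Finset ℤ → M) (B : Finset ℤ) :
    ∑ A ∈ (shift B).powerset, f A = ∑ A ∈ B.powerset, f (shift A) :=
  (Finset.sum_equiv shiftIso.toEquiv (fun _ => by
    simp only [Finset.mem_powerset]; exact shift_subset_shift.symm) fun _ _ => rfl).symm

theorem truncate_translateOp (B : Finset ℤ) (Φ : FormalOp d) :
    truncate B (translateOp Φ) = translateChain d (truncate (shift B) Φ) := by
  simp only [truncate_apply, map_sum, sum_powerset_shift, term_translateOp]

theorem translateChain_lie (X Y : Chain d) :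
    translateChain d ⁅X, Y⁆ = ⁅translateChain d X, translateChain d Y⁆ := by
  rw [Ring.lie_def, Ring.lie_def, map_sub, map_mul, map_mul]

theorem translateChain_mem_iff {A : Finset ℤ} {X : Chain d} :
    translateChain d X ∈ localAlg d A ↔ X ∈ localAlg d (shift A) := by
  constructor
  · rintro ⟨Y, hY⟩
    refine ⟨Y.submatrix (shiftConfigEquiv A).symm (shiftConfigEquiv A).symm, ?_⟩
    apply (translateChain d).injective
    change translateChain d (toChain (shift A) _) = _
    rw [← hY, translateChain_toChain]
    exact congrArg (toChain A) (Matrix.ext fun s t =>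
      congrArg₂ Y ((shiftConfigEquiv A).symm_apply_apply s)
        ((shiftConfigEquiv A).symm_apply_apply t))
  · rintro ⟨Y, rfl⟩
    exact ⟨_, (translateChain_toChain A Y).symm⟩

theorem AtMostLocal.translateOp {n : ℕ} {Φ : FormalOp d} (h : AtMostLocal n Φ) :
    AtMostLocal n (translateOp Φ) := by
  intro A hA
  obtain ⟨i, hi⟩ := h (shift A) fun e => hA (Subtype.ext (by
    ext s t
    change (Φ (shift A) : Op d (shift A)) _ _ = _
    rw [e]
    rfl))
  refine ⟨i - 1, fun j hj => ?_⟩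
  have := Finset.mem_Ico.1 (hi (mem_shift.2 (show j + 1 - 1 ∈ A by simpa using hj)))
  rw [Finset.mem_Ico]
  omega

theorem translateOp_mem_finiteRange {Φ : FormalOp d} (h : Φ ∈ finiteRange d) :
    translateOp Φ ∈ finiteRange d := by
  obtain ⟨n, hn⟩ := mem_finiteRange.1 h
  exact hn.translateOp.mem_finiteRange

section Translate

variable [NeZero d]

theorem termOp_coeff_translateChain {A B : Finset ℤ} (h : A ⊆ B) {X : Chain d}
    (hX : X ∈ localAlg d (shift B)) : termOp A (coeff A (translateChain d X)) =
      translateChain d (termOp (shift A) (coeff (shift A) X)) := by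
  have hsum : X = truncate (shift B) fun C => coeff C X := by
    rw [truncate_apply]
    exact eq_sum_coeff hX
  conv_lhs => rw [hsum, ← truncate_translateOp, coeff_truncate h]
  exact term_translateOp A _

theorem translateOp_opComm {Φ Ψ : FormalOp d} (hΦ : Φ ∈ finiteRange d) (hΨ : Ψ ∈ finiteRange d) :
    translateOp (opComm Φ Ψ) = opComm (translateOp Φ) (translateOp Ψ) := by
  refine formalOp_ext fun A => ?_
  obtain ⟨B, h₁, h₂, hAB⟩ := (eventually_coeff_lie (translateOp_mem_finiteRange hΦ)
    (translateOp_mem_finiteRange hΨ) A |>.and <| shiftIso.tendsto_atTop.eventually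
      (eventually_coeff_lie hΦ hΨ (shift A)) |>.and <| eventually_ge_atTop A).exists
  rw [term_translateOp]
  change translateChain d (termOp _ (opComm Φ Ψ _)) = termOp A (opComm _ _ A)
  rw [← h₁, ← h₂, truncate_translateOp, truncate_translateOp, ← translateChain_lie,
    termOp_coeff_translateChain hAB (lie_mem_localAlg (truncate_mem _ _) (truncate_mem _ _))]
  rfl

/-- The translation of the operators of finite range. -/
def translate (d : ℕ) [NeZero d] : finiteRange d →ₗ⁅ℂ⁆ finiteRange d where
  toFun Φ := ⟨translateOp Φ, translateOp_mem_finiteRange Φ.2⟩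
  map_add' _ _ := rfl
  map_smul' _ _ := rfl
  map_lie' {Φ Ψ} := Subtype.ext (translateOp_opComm Φ.2 Ψ.2)

end Translate

/-! ### The normalized trace -/

section Trace

variable [NeZero d]

/-- The normalized trace of the operators which act on finitely many sites. -/
def chainTrace : Chain d →ₗ[ℂ] ℂ :=
  (Matrix.traceLinearMap _ ℂ ℂ ∘ₗ (Op₀ d ∅).subtype) ∘ₗ coeff ∅

theorem chainTrace_apply (X : Chain d) : chainTrace X = (coeff ∅ X : Op d ∅).trace := rfl

theorem chainTrace_toChain {A : Finset ℤ} (Y : Op d A) :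
    chainTrace (toChain A Y) = (d : ℂ)⁻¹ ^ A.card * Y.trace := by
  rw [chainTrace_apply, coeff_toChain (Finset.empty_subset A), Matrix.trace]
  simp [component, componentOp_empty]

theorem chainTrace_mul_comm {X Y : Chain d} (hX : X ∈ localOps d) (hY : Y ∈ localOps d) :
    chainTrace (X * Y) = chainTrace (Y * X) := by
  obtain ⟨A, hA⟩ := mem_localOps.1 hX
  obtain ⟨B, hB⟩ := mem_localOps.1 hY
  have h := coeff_empty_lie (localAlg_mono (Finset.subset_union_left (s₂ := B)) hA)
    (localAlg_mono Finset.subset_union_right hB)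
  rw [Ring.lie_def, map_sub, sub_eq_zero] at h
  rw [chainTrace_apply, h, chainTrace_apply]

theorem chainTrace_siteTrace (i : ℤ) {X : Chain d} (hX : X ∈ localOps d) :
    chainTrace (siteTrace d i X) = chainTrace X := by
  obtain ⟨A, hA⟩ := mem_localOps.1 hX
  rw [chainTrace_apply, coeff_siteTrace_of_notMem (Finset.notMem_empty i) hA, chainTrace_apply]

theorem chainTrace_mul_eq_zero {A B : Finset ℤ} (h : A ≠ B) {X Y : Chain d}
    (hX : X ∈ traceless d A) (hY : Y ∈ traceless d B) : chainTrace (X * Y) = 0 := by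
  have hXA := traceless_le_localAlg A hX
  have hYB := traceless_le_localAlg B hY
  have hXY : X * Y ∈ localOps d :=
    mul_mem (mem_localOps.2 ⟨A, hXA⟩) (mem_localOps.2 ⟨B, hYB⟩)
  obtain ⟨i, ⟨hA, hB⟩ | ⟨hB, hA⟩⟩ : ∃ i, (i ∈ A ∧ i ∉ B) ∨ (i ∈ B ∧ i ∉ A) := by
    by_contra! hc
    exact h (Finset.ext fun i => ⟨(hc i).1, (hc i).2⟩)
  · rw [← chainTrace_siteTrace i hXY, siteTrace_mul_right hB hYB, siteTrace_traceless hA hX,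
      zero_mul, map_zero]
  · rw [← chainTrace_siteTrace i hXY, siteTrace_mul_left hA hXA, siteTrace_traceless hB hY,
      mul_zero, map_zero]

theorem chainTrace_mul_eq_coeff {A : Finset ℤ} {X Y : Chain d} (hX : X ∈ traceless d A)
    (hY : Y ∈ localOps d) : chainTrace (X * Y) = chainTrace (X * termOp A (coeff A Y)) := by
  obtain ⟨B, hB⟩ := mem_localOps.1 hY
  conv_lhs => rw [eq_sum_coeff hB, Finset.mul_sum, map_sum]
  refine Finset.sum_eq_single A (fun C _ hC => ?_) fun hA => ?_
  · exact chainTrace_mul_eq_zero hC.symm hX (termOp_mem_traceless C _)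
  · rw [coeff_eq_zero hB (mt Finset.mem_powerset.2 hA), map_zero, mul_zero, map_zero]

theorem chainTrace_translateChain {X : Chain d} (hX : X ∈ localOps d) :
    chainTrace (translateChain d X) = chainTrace X := by
  obtain ⟨A, hA⟩ := mem_localOps.1 hX
  obtain ⟨B, rfl⟩ : ∃ B, shift B = A := shiftIso.surjective A
  obtain ⟨Y, rfl⟩ := hA
  change chainTrace (translateChain d (toChain (shift B) Y)) = chainTrace (toChain (shift B) Y)
  rw [translateChain_toChain, chainTrace_toChain, chainTrace_toChain,
    show (shift B).card = B.card from Finset.card_map _]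
  exact congrArg _ (Fintype.sum_equiv (shiftConfigEquiv B) _ _ fun s => rfl)

theorem chainTrace_mul_formalLie {Φ : FormalOp d} (hΦ : Φ ∈ finiteRange d) {X Y : Chain d}
    (hX : X ∈ localOps d) (hY : Y ∈ localOps d) :
    chainTrace (X * formalLie Φ Y) = -chainTrace (Y * formalLie Φ X) := by
  obtain ⟨B, hBX, hBY⟩ :=
    ((eventually_lie_truncate hΦ hX).and (eventually_lie_truncate hΦ hY)).exists
  have hB : truncate B Φ ∈ localOps d := mem_localOps.2 ⟨B, truncate_mem B Φ⟩
  rw [← hBX, ← hBY, Ring.lie_def, Ring.lie_def, mul_sub, mul_sub, map_sub, map_sub,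
    ← mul_assoc X _ Y, chainTrace_mul_comm (mul_mem hX hB) hY, ← mul_assoc Y _ X,
    chainTrace_mul_comm (mul_mem hY hB) hX, neg_sub]

end Trace

/-! ### Adjoints -/

theorem conjTranspose_mem {A : Finset ℤ} {X : Op d A} (hX : X ∈ Op₀ d A) :
    X.conjTranspose ∈ Op₀ d A := by
  intro i s t
  simpa using congrArg star (hX i t s)

/-- The adjoint `Φ†` of a formal operator. -/
def adjoint (Φ : FormalOp d) : FormalOp d := fun A =>
  ⟨(Φ A : Op d A).conjTranspose, conjTranspose_mem (Φ A).2⟩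

theorem adjoint_eq_self {Φ : FormalOp d} (h : IsSelfAdj Φ) : adjoint Φ = Φ :=
  funext fun A => Subtype.ext (h A)

theorem adjoint_zero : adjoint (0 : FormalOp d) = 0 :=
  funext fun _ => Subtype.ext Matrix.conjTranspose_zero

theorem AtMostLocal.adjoint {n : ℕ} {Φ : FormalOp d} (h : AtMostLocal n Φ) :
    AtMostLocal n (adjoint Φ) := by
  refine fun A hA => h A fun hΦ => hA (Subtype.ext ?_)
  change (Φ A : Op d A).conjTranspose = 0
  rw [hΦ, Submodule.coe_zero, Matrix.conjTranspose_zero]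

theorem embed_conjTranspose {A B : Finset ℤ} (h : A ⊆ B) (X : Op d A) :
    embed h X.conjTranspose = (embed h X).conjTranspose := by
  ext s t
  simp only [embed, Matrix.conjTranspose_apply, apply_ite star, star_zero, eq_comm]

theorem restrict_adjoint (Φ : FormalOp d) (B : Finset ℤ) :
    restrict (adjoint Φ) B = (restrict Φ B).conjTranspose := by
  rw [restrict, restrict, Matrix.conjTranspose_sum]
  exact Finset.sum_congr rfl fun A _ => embed_conjTranspose _ _

theorem star_tracelessKernel (a b a' b' : Fin d) :
    star (tracelessKernel a b a' b') = tracelessKernel b a b' a' := by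
  simp only [tracelessKernel, star_sub, star_mul', star_inv₀, star_natCast, apply_ite star,
    star_one, star_zero, and_comm, eq_comm]

theorem componentOp_conjTranspose {A B : Finset ℤ} (h : A ⊆ B) (Y : Op d B) :
    componentOp h Y.conjTranspose = (componentOp h Y).conjTranspose := by
  ext s t
  simp only [componentOp, Matrix.conjTranspose_apply, star_sum, star_mul', star_prod,
    star_tracelessKernel, apply_ite star, star_one, star_zero, star_inv₀, star_natCast]
  rw [Finset.sum_comm]
  simp only [eq_comm]

section Adjoint

variable [NeZero d]

theorem opComm_adjoint {Φ Ψ : FormalOp d} {m n : ℕ} (hΦ : AtMostLocal m Φ)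
    (hΨ : AtMostLocal n Ψ) : opComm (adjoint Φ) (adjoint Ψ) = adjoint (opComm Ψ Φ) := by
  funext A
  obtain ⟨B, h, h', hAB⟩ :=
    (eventually_coeff_lie hΦ.adjoint.mem_finiteRange hΨ.adjoint.mem_finiteRange A |>.and <|
      eventually_coeff_lie hΨ.mem_finiteRange hΦ.mem_finiteRange A |>.and <|
      eventually_ge_atTop A).exists
  rw [← component_commutator hAB] at h h'
  refine Subtype.ext ?_
  change _ = (opComm Ψ Φ A : Op d A).conjTranspose
  rw [← h, ← h']
  change componentOp hAB _ = (componentOp hAB _).conjTranspose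
  rw [restrict_adjoint, restrict_adjoint, ← componentOp_conjTranspose, Matrix.conjTranspose_sub,
    Matrix.conjTranspose_mul, Matrix.conjTranspose_mul]

open scoped ComplexOrder

theorem chainTrace_adjoint_mul (Φ : FormalOp d) (A : Finset ℤ) :
    chainTrace (term A (adjoint Φ) * term A Φ) =
      (d : ℂ)⁻¹ ^ A.card * ((Φ A : Op d A).conjTranspose * (Φ A : Op d A)).trace := by
  rw [← chainTrace_toChain, map_mul (toChain A)]
  rfl

theorem chainTrace_adjoint_mul_nonneg (Φ : FormalOp d) (A : Finset ℤ) :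
    0 ≤ chainTrace (term A (adjoint Φ) * term A Φ) := by
  rw [chainTrace_adjoint_mul]
  exact mul_nonneg (by positivity) (Matrix.posSemidef_conjTranspose_mul_self _).trace_nonneg

theorem chainTrace_adjoint_mul_eq_zero_iff {Φ : FormalOp d} {A : Finset ℤ} :
    chainTrace (term A (adjoint Φ) * term A Φ) = 0 ↔ Φ A = 0 := by
  have hd : (d : ℂ)⁻¹ ^ A.card ≠ 0 := pow_ne_zero _ (inv_ne_zero (NeZero.ne _))
  rw [chainTrace_adjoint_mul, mul_eq_zero_iff_left hd,
    Matrix.trace_conjTranspose_mul_self_eq_zero_iff, Submodule.coe_eq_zero]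

end Adjoint

/-! ### Mass transport -/

section MassTransport

variable {G α M : Type*} [AddGroup G] [AddAction G α] [AddCommMonoid M] {S : Finset α}

theorem finsum_eq_sum_finsum_vadd (hS : Function.Injective fun p : S × G => p.2 +ᵥ (p.1 : α))
    {f : α → M} (hf : (Function.support f).Finite)
    (hfS : Function.support f ⊆ Set.range fun p : S × G => p.2 +ᵥ (p.1 : α)) :
    ∑ᶠ a, f a = ∑ a ∈ S, ∑ᶠ g : G, f (g +ᵥ a) := by
  rw [← finsum_mem_univ, ← finsum_mem_inter_support, Set.univ_inter,
    ← Set.inter_eq_right.2 hfS, finsum_mem_inter_support, finsum_mem_range hS,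
    finsum_curry _ (hf.preimage hS.injOn), finsum_eq_sum_of_fintype]
  exact Finset.sum_coe_sort S fun a => ∑ᶠ g : G, f (g +ᵥ a)

theorem sum_finsum_comm_of_vadd_invariant
    (hS : Function.Injective fun p : S × G => p.2 +ᵥ (p.1 : α)) {F : α → α → M}
    (hF : ∀ (g : G) a b, F (g +ᵥ a) (g +ᵥ b) = F a b)
    (hl : ∀ b, (Function.support fun a => F a b).Finite)
    (hr : ∀ a, (Function.support (F a)).Finite)
    (hlS : ∀ b, (Function.support fun a => F a b) ⊆
      Set.range fun p : S × G => p.2 +ᵥ (p.1 : α))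
    (hrS : ∀ a, Function.support (F a) ⊆ Set.range fun p : S × G => p.2 +ᵥ (p.1 : α)) :
    ∑ a ∈ S, ∑ᶠ b, F a b = ∑ b ∈ S, ∑ᶠ a, F a b := by
  simp only [finsum_eq_sum_finsum_vadd hS (hr _) (hrS _),
    finsum_eq_sum_finsum_vadd hS (hl _) (hlS _)]
  rw [Finset.sum_comm]
  refine Finset.sum_congr rfl fun b _ => Finset.sum_congr rfl fun a _ => ?_
  rw [← finsum_comp_equiv (Equiv.neg G)]
  refine finsum_congr fun g => ?_
  rw [← hF g, Equiv.neg_apply, vadd_vadd, add_neg_cancel, zero_vadd]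

end MassTransport

/-! ### Double commutators of translation-invariant operators -/

open scoped Pointwise

theorem eq_of_one_vadd_eq {α M : Type*} [AddAction ℤ α] {f : α → M}
    (h : ∀ a, f ((1 : ℤ) +ᵥ a) = f a) (k : ℤ) (a : α) : f (k +ᵥ a) = f a := by
  induction k using Int.induction_on with
  | zero => rw [zero_vadd]
  | succ n ih => rw [add_comm, ← vadd_vadd, h, ih]
  | pred n ih => rw [← h, vadd_vadd, add_sub_cancel, ih]

theorem mem_vadd_iff_sub_mem {k j : ℤ} {A : Finset ℤ} : j ∈ k +ᵥ A ↔ j - k ∈ A := by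
  rw [← Finset.neg_vadd_mem_iff, vadd_eq_add, neg_add_eq_sub]

theorem one_vadd_eq_shift (A : Finset ℤ) : (1 : ℤ) +ᵥ A = shift A :=
  Finset.ext fun _ => mem_vadd_iff_sub_mem.trans mem_shift.symm

/-- The subsets of `{0, …, m - 1}` with minimum `0`, which represent the sets of at most `m`
contiguous sites up to translation. -/
def anchored (m : ℕ) : Finset (Finset ℤ) := {A ∈ (Finset.Ico 0 (m : ℤ)).powerset | 0 ∈ A}

theorem mem_anchored {m : ℕ} {A : Finset ℤ} :
    A ∈ anchored m ↔ A ⊆ Finset.Ico 0 (m : ℤ) ∧ 0 ∈ A := by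
  rw [anchored, Finset.mem_filter, Finset.mem_powerset]

theorem vadd_anchored_injective (m : ℕ) :
    Function.Injective fun p : anchored m × ℤ => p.2 +ᵥ (p.1 : Finset ℤ) := by
  have hle : ∀ {A B : anchored m} {k l : ℤ}, k +ᵥ (A : Finset ℤ) = l +ᵥ (B : Finset ℤ) →
      l ≤ k := by
    intro A B k l h
    have hk : k ∈ l +ᵥ (B : Finset ℤ) := by
      rw [← h, mem_vadd_iff_sub_mem, sub_self]
      exact (mem_anchored.1 A.2).2
    exact sub_nonneg.1
      (Finset.mem_Ico.1 ((mem_anchored.1 B.2).1 (mem_vadd_iff_sub_mem.1 hk))).1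
  rintro ⟨A, k⟩ ⟨B, l⟩ h
  obtain rfl : k = l := le_antisymm (hle h.symm) (hle h)
  exact congrArg (·, k) (Subtype.ext (vadd_left_cancel k h))

theorem mem_range_vadd_anchored {m : ℕ} {A : Finset ℤ} (hA : A.Nonempty)
    (h : ∃ i : ℤ, A ⊆ Finset.Ico i (i + m)) :
    A ∈ Set.range fun p : anchored m × ℤ => p.2 +ᵥ (p.1 : Finset ℤ) := by
  obtain ⟨i, hi⟩ := h
  refine ⟨⟨⟨-A.min' hA +ᵥ A, mem_anchored.2 ⟨fun j hj => ?_, ?_⟩⟩, A.min' hA⟩,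
    vadd_neg_vadd _ _⟩
  · rw [mem_vadd_iff_sub_mem, sub_neg_eq_add] at hj
    have h₁ := Finset.mem_Ico.1 (hi hj)
    have h₂ := Finset.mem_Ico.1 (hi (A.min'_mem hA))
    have h₃ := A.min'_le _ hj
    rw [Finset.mem_Ico]
    omega
  · rw [mem_vadd_iff_sub_mem, zero_sub, neg_neg]
    exact A.min'_mem hA

theorem translateChain_formalLie (Φ : FormalOp d) (X : Chain d) :
    translateChain d (formalLie Φ X) = formalLie (translateOp Φ) (translateChain d X) := by
  simp only [formalLie, term_translateOp, ← translateChain_lie]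
  rw [← finsum_comp_equiv shiftIso.toEquiv]
  exact (translateChain d).toLinearEquiv.toAddEquiv.map_finsum _

theorem term_mem_localOps (A : Finset ℤ) (Φ : FormalOp d) : term A Φ ∈ localOps d :=
  mem_localOps.2 ⟨A, term_mem A Φ⟩

section Transport

variable [NeZero d]

theorem coeff_formalLie {Φ : FormalOp d} (hΦ : Φ ∈ finiteRange d) (A : Finset ℤ) {X : Chain d}
    (hX : X ∈ localOps d) : coeff A (formalLie Φ X) = ∑ᶠ C, coeff A ⁅term C Φ, X⁆ :=
  map_finsum _ (finite_support_lie_term hΦ hX)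

theorem exists_coeff_lie_term_ne_zero {Φ Ψ : FormalOp d} (hΦ : Φ ∈ finiteRange d)
    {A C : Finset ℤ} (h : coeff A (formalLie Φ (term C Ψ)) ≠ 0) :
    ∃ D, coeff A ⁅term D Φ, term C Ψ⁆ ≠ 0 := by
  contrapose! h
  rw [coeff_formalLie hΦ A (term_mem_localOps C Ψ), finsum_eq_zero_of_forall_eq_zero h]

theorem finite_support_coeff_formalLie_term {Φ Ψ : FormalOp d} (hΦ : Φ ∈ finiteRange d)
    (hΨ : Ψ ∈ finiteRange d) (A : Finset ℤ) :
    (Function.support fun C => coeff A (formalLie Φ (term C Ψ))).Finite := by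
  refine ((finite_support_coeff_lie_term hΦ hΨ A).image Prod.snd).subset fun C hC => ?_
  obtain ⟨D, hD⟩ := exists_coeff_lie_term_ne_zero hΦ hC
  exact ⟨(D, C), hD, rfl⟩

theorem opComm_eq_finsum_formalLie {Φ Ψ : FormalOp d} (hΦ : Φ ∈ finiteRange d)
    (hΨ : Ψ ∈ finiteRange d) (A : Finset ℤ) :
    opComm Φ Ψ A = ∑ᶠ C, coeff A (formalLie Φ (term C Ψ)) := by
  have hf := finite_support_coeff_lie_term hΦ hΨ A
  rw [opComm_eq_finsum hΦ hΨ, ← finsum_comp_equiv (Equiv.prodComm _ _),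
    finsum_curry _ (hf.preimage (Equiv.injective _).injOn)]
  exact finsum_congr fun C => (coeff_formalLie hΦ A (term_mem_localOps C Ψ)).symm

/-- The contribution `tr(Θ(A) [Φ, Ψ(C)])` of the sites `C` to the pairing of `Θ(A)` with
`[Φ, Ψ](A)`. -/
def transport (Φ Θ Ψ : FormalOp d) (A C : Finset ℤ) : ℂ :=
  chainTrace (term A Θ * formalLie Φ (term C Ψ))

theorem transport_swap {Φ : FormalOp d} (hΦ : Φ ∈ finiteRange d) (Θ Ψ : FormalOp d)
    (A C : Finset ℤ) : transport Φ Θ Ψ A C = -transport Φ Ψ Θ C A :=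
  chainTrace_mul_formalLie hΦ (term_mem_localOps A Θ) (term_mem_localOps C Ψ)

theorem transport_eq_coeff {Φ : FormalOp d} (hΦ : Φ ∈ finiteRange d) (Θ Ψ : FormalOp d)
    (A C : Finset ℤ) : transport Φ Θ Ψ A C =
      (chainTrace ∘ₗ LinearMap.mulLeft ℂ (term A Θ) ∘ₗ termOp A)
        (coeff A (formalLie Φ (term C Ψ))) :=
  chainTrace_mul_eq_coeff (term_mem_traceless A Θ) (formalLie_mem hΦ (term_mem_localOps C Ψ))

theorem finite_support_transport {Φ Ψ : FormalOp d} (hΦ : Φ ∈ finiteRange d)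
    (Θ : FormalOp d) (hΨ : Ψ ∈ finiteRange d) (A : Finset ℤ) :
    (Function.support (transport Φ Θ Ψ A)).Finite := by
  refine (finite_support_coeff_formalLie_term hΦ hΨ A).subset fun C hC h => hC ?_
  rw [transport_eq_coeff hΦ]
  exact (congrArg _ h).trans (map_zero _)

theorem finsum_transport {Φ Ψ : FormalOp d} (hΦ : Φ ∈ finiteRange d) (Θ : FormalOp d)
    (hΨ : Ψ ∈ finiteRange d) (A : Finset ℤ) :
    ∑ᶠ C, transport Φ Θ Ψ A C = chainTrace (term A Θ * term A (opComm Φ Ψ)) := by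
  simp only [transport_eq_coeff hΦ]
  rw [← map_finsum _ (finite_support_coeff_formalLie_term hΦ hΨ A),
    ← opComm_eq_finsum_formalLie hΦ hΨ]
  rfl

theorem transport_ne_zero {Φ Θ Ψ : FormalOp d} (hΦ : Φ ∈ finiteRange d) {A C : Finset ℤ}
    (h : transport Φ Θ Ψ A C ≠ 0) : A.Nonempty ∧ Ψ C ≠ 0 := by
  have hcoeff : coeff A (formalLie Φ (term C Ψ)) ≠ 0 := fun e => h <| by
    rw [transport_eq_coeff hΦ, e, map_zero]
  obtain ⟨D, hD⟩ := exists_coeff_lie_term_ne_zero hΦ hcoeff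
  obtain ⟨-, hC, -, hA, -⟩ := coeff_lie_term_ne_zero hD
  exact ⟨hA, hC⟩

theorem support_transport_subset {Φ Θ Ψ : FormalOp d} (hΦ : Φ ∈ finiteRange d) {m : ℕ}
    (hΨ : AtMostLocal m Ψ) (A : Finset ℤ) : Function.support (transport Φ Θ Ψ A) ⊆
      Set.range fun p : anchored m × ℤ => p.2 +ᵥ (p.1 : Finset ℤ) := by
  intro C hC
  have hC' : transport Φ Ψ Θ C A ≠ 0 := fun h => hC (by rw [transport_swap hΦ, h, neg_zero])
  exact mem_range_vadd_anchored (transport_ne_zero hΦ hC').1 (hΨ C (transport_ne_zero hΦ hC).2)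

theorem transport_vadd {Φ Θ Ψ : FormalOp d} (hΦ : Φ ∈ finiteRange d) (hΦT : translateOp Φ = Φ)
    (hΘT : translateOp Θ = Θ) (hΨT : translateOp Ψ = Ψ) (k : ℤ) (A C : Finset ℤ) :
    transport Φ Θ Ψ (k +ᵥ A) (k +ᵥ C) = transport Φ Θ Ψ A C := by
  refine eq_of_one_vadd_eq (f := fun p : Finset ℤ × Finset ℤ => transport Φ Θ Ψ p.1 p.2)
    (fun p => ?_) k (A, C)
  change transport Φ Θ Ψ ((1 : ℤ) +ᵥ p.1) ((1 : ℤ) +ᵥ p.2) = _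
  rw [one_vadd_eq_shift, one_vadd_eq_shift, transport, ← chainTrace_translateChain (mul_mem
      (term_mem_localOps _ Θ) (formalLie_mem hΦ (term_mem_localOps _ Ψ))), map_mul,
    translateChain_formalLie, ← term_translateOp, ← term_translateOp, hΦT, hΘT, hΨT, transport]

theorem sum_chainTrace_mul_opComm {m : ℕ} {Φ Θ Ψ : FormalOp d} (hΦ : Φ ∈ finiteRange d)
    (hΦT : translateOp Φ = Φ) (hΘ : AtMostLocal m Θ) (hΘT : translateOp Θ = Θ)
    (hΨ : AtMostLocal m Ψ) (hΨT : translateOp Ψ = Ψ) :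
    ∑ A ∈ anchored m, chainTrace (term A Θ * term A (opComm Φ Ψ)) =
      -∑ A ∈ anchored m, chainTrace (term A Ψ * term A (opComm Φ Θ)) := by
  have hneg : ∀ C, (fun A => transport Φ Θ Ψ A C) = -transport Φ Ψ Θ C := fun C =>
    funext fun A => transport_swap hΦ Θ Ψ A C
  simp only [← finsum_transport hΦ _ hΨ.mem_finiteRange, ← finsum_transport hΦ _ hΘ.mem_finiteRange]
  rw [sum_finsum_comm_of_vadd_invariant (vadd_anchored_injective m)
    (transport_vadd hΦ hΦT hΘT hΨT), ← Finset.sum_neg_distrib]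
  · refine Finset.sum_congr rfl fun C _ => ?_
    rw [hneg]
    exact finsum_neg_distrib _
  · intro C
    rw [hneg, Function.support_neg]
    exact finite_support_transport hΦ Ψ hΘ.mem_finiteRange C
  · exact finite_support_transport hΦ Θ hΨ.mem_finiteRange
  · intro C
    rw [hneg, Function.support_neg]
    exact support_transport_subset hΦ hΘ C
  · exact support_transport_subset hΦ hΨ

theorem eq_zero_of_translateOp_eq {Φ : FormalOp d} {m : ℕ} (hΦ : AtMostLocal m Φ)
    (hΦT : translateOp Φ = Φ) (h0 : Φ ∅ = 0) (h : ∀ A ∈ anchored m, Φ A = 0) : Φ = 0 := by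
  have hshift : ∀ A, (Φ ((1 : ℤ) +ᵥ A) = 0) = (Φ A = 0) := fun A => by
    rw [one_vadd_eq_shift, ← term_eq_zero_iff, ← term_eq_zero_iff]
    conv_rhs => rw [← hΦT, term_translateOp, EmbeddingLike.map_eq_zero_iff]
  funext A
  by_contra hA
  have hne : A.Nonempty := by
    rw [Finset.nonempty_iff_ne_empty]
    rintro rfl
    exact hA h0
  obtain ⟨⟨⟨C, hC⟩, k⟩, rfl⟩ := mem_range_vadd_anchored hne (hΦ A hA)
  exact hA ((eq_of_one_vadd_eq (f := fun A => Φ A = 0) hshift k C).mpr (h C hC))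

open scoped ComplexOrder in
theorem lie_eq_zero_of_lie_lie_eq_zero {Φ Ψ : finiteRange d} (hΦ : IsSelfAdj (Φ : FormalOp d))
    (hΦT : translate d Φ = Φ) (hΨT : translate d Ψ = Ψ) (h : ⁅Φ, ⁅Φ, Ψ⁆⁆ = 0) : ⁅Φ, Ψ⁆ = 0 := by
  obtain ⟨l, hl⟩ := mem_finiteRange.1 Φ.2
  obtain ⟨m, hm⟩ := mem_finiteRange.1 Ψ.2
  obtain ⟨n, hn⟩ := mem_finiteRange.1 ⁅Φ, Ψ⁆.2
  have hΨ' : AtMostLocal (m + n) (Ψ : FormalOp d) := atMostLocal_mono (Nat.le_add_right m n) hm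
  have hn' : AtMostLocal (m + n) (⁅Φ, Ψ⁆ : finiteRange d).1 :=
    atMostLocal_mono (Nat.le_add_left n m) hn
  have hT : translate d ⁅Φ, Ψ⁆ = ⁅Φ, Ψ⁆ := by rw [LieHom.map_lie, hΦT, hΨT]
  have hadj : opComm Φ.1 (adjoint (⁅Φ, Ψ⁆ : finiteRange d).1) = 0 := by
    conv_lhs => rw [← adjoint_eq_self hΦ]
    have h' : ⁅⁅Φ, Ψ⁆, Φ⁆ = 0 := by rw [← lie_skew, h, neg_zero]
    rw [opComm_adjoint hl hn, ← adjoint_zero]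
    exact congrArg adjoint (congrArg Subtype.val h')
  have hsum := sum_chainTrace_mul_opComm Φ.2 (congrArg Subtype.val hΦT) hn'.adjoint
    (congrArg adjoint (congrArg Subtype.val hT)) hΨ' (congrArg Subtype.val hΨT)
  simp only [hadj, map_zero, mul_zero, Finset.sum_const_zero, neg_zero] at hsum
  replace hsum := (Finset.sum_eq_zero_iff_of_nonneg fun A _ =>
    chainTrace_adjoint_mul_nonneg (⁅Φ, Ψ⁆ : finiteRange d).1 A).1 hsum
  exact Subtype.ext <| eq_zero_of_translateOp_eq hn' (congrArg Subtype.val hT)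
    (opComm_empty Φ.2 Ψ.2) fun A hA => chainTrace_adjoint_mul_eq_zero_iff.1 (hsum A hA)

end Transport

/-! ### Factorization of operators on three sites -/

theorem slice_lie {A : Finset ℤ} {X : Chain d}
    (hX : X ∈ Subalgebra.centralizer ℂ (localAlg d A : Set (Chain d))) (s t : A → Fin d)
    (Y : Chain d) : slice A s t ⁅X, Y⁆ = ⁅X, slice A s t Y⁆ := by
  rw [Ring.lie_def, Ring.lie_def, map_sub, slice_mul_left hX, slice_mul_right hX]

/-- No nonzero traceless operator on the sites `A` commutes with `h`. -/
def LieInjOn (h : Chain d) (A : Finset ℤ) : Prop := ∀ y ∈ traceless d A, ⁅h, y⁆ = 0 → y = 0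

/-- The amplification `id ⊗ L` of a linear map `L` from the operators on `B` to the traceless
operators on `A`. It is encoded with `L` defined on all operators on the chain, although only its
values on the operators on `B` matter. -/
def amplify {A : Finset ℤ} (B : Finset ℤ) (L : Chain d →ₗ[ℂ] Op₀ d A) : Chain d →ₗ[ℂ] Chain d :=
  ∑ s, ∑ t, LinearMap.mulRight ℂ (termOp A (L (unit B s t))) ∘ₗ slice B s t

theorem amplify_apply {A : Finset ℤ} (B : Finset ℤ) (L : Chain d →ₗ[ℂ] Op₀ d A) (X : Chain d) :
    amplify B L X = ∑ s, ∑ t, slice B s t X * termOp A (L (unit B s t)) := by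
  simp [amplify]

theorem amplify_mul {A B : Finset ℤ} (L : Chain d →ₗ[ℂ] Op₀ d A) {X Y : Chain d}
    (hX : X ∈ Subalgebra.centralizer ℂ (localAlg d B : Set (Chain d))) (hY : Y ∈ localAlg d B) :
    amplify B L (X * Y) = X * termOp A (L Y) := by
  obtain ⟨Y, rfl⟩ := hY
  change amplify B L (X * toChain B Y) = X * termOp A (L (toChain B Y))
  simp only [amplify_apply, slice_mul_toChain hX, smul_mul_assoc]
  simp only [toChain_eq_sum_unit, map_sum, map_smul, Finset.mul_sum, mul_smul_comm]

theorem amplify_lie {A B : Finset ℤ} (hAB : A ⊆ B) (L : Chain d →ₗ[ℂ] Op₀ d A) {X : Chain d}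
    (hX : X ∈ Subalgebra.centralizer ℂ (localAlg d B : Set (Chain d))) (Y : Chain d) :
    amplify B L ⁅X, Y⁆ = ⁅X, amplify B L Y⁆ := by
  simp only [amplify_apply, lie_sum]
  refine Finset.sum_congr rfl fun s _ => Finset.sum_congr rfl fun t _ => ?_
  have h : Commute X (termOp A (L (unit B s t))) :=
    ((Subalgebra.mem_centralizer_iff ℂ).1 hX _ (localAlg_mono hAB (termOp_mem A _))).symm
  rw [slice_lie hX, Ring.lie_def, Ring.lie_def, sub_mul, mul_assoc, mul_assoc, mul_assoc, h.eq]

theorem eq_sum_slice_mul_of_siteTrace_eq_zero {j : ℤ} {A : Finset ℤ} (hj : j ∉ A) {X : Chain d}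
    (hX : X ∈ localAlg d (A ∪ {j})) (h0 : siteTrace d j X = 0) :
    X = ∑ s, ∑ t, slice {j} s t X * (unit {j} s t - siteTrace d j (unit {j} s t)) := by
  have hs (s t) : slice {j} s t X ∈ localAlg d A := slice_mem (by simpa using hj) s t hX
  have hsum : ∑ s, ∑ t, slice {j} s t X * siteTrace d j (unit {j} s t) = 0 := by
    simp only [← siteTrace_mul_left hj (hs _ _), ← map_sum, ← eq_sum_slice_mul_unit, h0]
  simp only [mul_sub, Finset.sum_sub_distrib, hsum, sub_zero, ← eq_sum_slice_mul_unit]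

section Factorization

variable [NeZero d]

theorem amplify_mem {A B C : Finset ℤ} (hAB : A ⊆ B) (hCB : Disjoint C B)
    (L : Chain d →ₗ[ℂ] Op₀ d A) {X : Chain d} (hX : X ∈ traceless d (C ∪ B)) :
    amplify B L X ∈ traceless d (C ∪ A) := by
  have hs (s t) : slice B s t X ∈ localAlg d C := slice_mem hCB s t (traceless_le_localAlg _ hX)
  rw [mem_traceless, amplify_apply]
  refine ⟨sum_mem fun s _ => sum_mem fun t _ =>
    mul_mem (localAlg_mono Finset.subset_union_left (hs s t))
      (localAlg_mono Finset.subset_union_right (termOp_mem A _)), fun i hi => ?_⟩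
  simp only [map_sum]
  refine Finset.sum_eq_zero fun s _ => Finset.sum_eq_zero fun t _ => ?_
  by_cases hiB : i ∈ B
  · have hiC : i ∉ C := Finset.disjoint_right.1 hCB hiB
    have hiA : i ∈ A := (Finset.mem_union.1 hi).resolve_left hiC
    rw [siteTrace_mul_left hiC (hs s t), siteTrace_traceless hiA (termOp_mem_traceless A _),
      mul_zero]
  · have hiA : i ∉ A := fun h => hiB (hAB h)
    rw [siteTrace_mul_right hiA (termOp_mem A _), siteTrace_slice hiB,
      siteTrace_traceless (by simp_all) hX, map_zero, zero_mul]

theorem sub_siteTrace_mem_traceless {j : ℤ} {X : Chain d} (hX : X ∈ localAlg d {j}) :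
    X - siteTrace d j X ∈ traceless d {j} := by
  have h : siteTrace d j X ∈ localAlg d (({j} : Finset ℤ).erase j) := siteTrace_mem j hX
  refine mem_traceless.2 ⟨sub_mem hX (localAlg_mono (Finset.erase_subset _ _) h), fun i hi => ?_⟩
  obtain rfl := Finset.mem_singleton.1 hi
  rw [map_sub, siteTrace_of_notMem (Finset.notMem_erase i _) h, sub_self]

theorem exists_amplify_lie_eq {j : ℤ} {B : Finset ℤ} (hj : j ∈ B) {h : Chain d}
    (hh : h ∈ localAlg d B) (hinj : LieInjOn h {j}) :
    ∃ L : Chain d →ₗ[ℂ] Op₀ d {j}, ∀ A : Finset ℤ, Disjoint A B → ∀ X ∈ localAlg d (A ∪ {j}),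
      siteTrace d j X = 0 → amplify B L ⁅h, X⁆ = X := by
  let f : Op₀ d {j} →ₗ[ℂ] Chain d := LieAlgebra.ad ℂ (Chain d) h ∘ₗ termOp {j}
  have hf : LinearMap.ker f = ⊥ := LinearMap.ker_eq_bot'.2 fun y hy =>
    (map_eq_zero_iff _ (termOp_injective {j})).1 (hinj _ (termOp_mem_traceless {j} y) hy)
  obtain ⟨L, hL⟩ := f.exists_leftInverse_of_injective hf
  have hLy (y) (hy : y ∈ traceless d {j}) : termOp {j} (L ⁅h, y⁆) = y := by
    obtain ⟨y, rfl⟩ := hy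
    exact congrArg (termOp {j}) (LinearMap.congr_fun hL y)
  refine ⟨L, fun A hA X hX h0 => ?_⟩
  have hjA : j ∉ A := Finset.disjoint_right.1 hA hj
  have hAj : Disjoint A {j} := Finset.disjoint_singleton_right.2 hjA
  have hmul (s t) (y) (hy : y ∈ traceless d {j}) :
      amplify B L ⁅h, slice {j} s t X * y⁆ = slice {j} s t X * y := by
    have hs := slice_mem hAj s t hX
    have hyB : y ∈ localAlg d B :=
      localAlg_mono (Finset.singleton_subset_iff.2 hj) (traceless_le_localAlg _ hy)
    have hlie : ⁅h, slice {j} s t X * y⁆ = slice {j} s t X * ⁅h, y⁆ := by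
      rw [Ring.lie_def, Ring.lie_def, mul_sub, ← mul_assoc,
        ← (commute_of_disjoint hA hs hh).eq, mul_assoc, mul_assoc]
    rw [hlie, amplify_mul L (localAlg_le_centralizer hA hs) (lie_mem_localAlg hh hyB), hLy y hy]
  conv_rhs => rw [eq_sum_slice_mul_of_siteTrace_eq_zero hjA hX h0]
  conv_lhs => rw [eq_sum_slice_mul_of_siteTrace_eq_zero hjA hX h0]
  simp only [lie_sum, map_sum, hmul _ _ _ (sub_siteTrace_mem_traceless (unit_mem _ _ _))]

theorem eq_zero_of_lie_eq_zero {j : ℤ} {B C : Finset ℤ} (hj : j ∉ B) (hCB : Disjoint C B)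
    {h : Chain d} (hh : h ∈ localAlg d C) (hinj : LieInjOn h {j})
    {X : Chain d} (hX : X ∈ localAlg d ({j} ∪ B)) (h0 : siteTrace d j X = 0) (hX0 : ⁅h, X⁆ = 0) :
    X = 0 := by
  have hslice (s t) : slice B s t X = 0 := by
    refine hinj _ (mem_traceless.2 ⟨slice_mem (by simpa using hj) s t hX, ?_⟩) ?_
    · intro i hi
      obtain rfl := Finset.mem_singleton.1 hi
      rw [siteTrace_slice hj, h0, map_zero]
    · rw [← slice_lie (localAlg_le_centralizer hCB hh), hX0, map_zero]
  rw [eq_sum_slice_mul_unit B X]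
  simp only [hslice, zero_mul, Finset.sum_const_zero]

theorem disjoint_pair_pair (i : ℤ) :
    Disjoint ({i, i + 1} : Finset ℤ) {i + 1 + 1, i + 1 + 1 + 1} := by
  simp only [Finset.disjoint_left, Finset.mem_insert, Finset.mem_singleton]
  omega

theorem lie_mem_traceless_triple {i : ℤ} {X Y : Chain d} (hX : X ∈ traceless d {i, i + 1})
    (hY : Y ∈ traceless d {i + 1, i + 1 + 1}) : ⁅X, Y⁆ ∈ traceless d {i, i + 1, i + 1 + 1} := by
  refine lie_mem_traceless (i := i + 1) ?_ ?_ hX hY <;> ext x <;>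
    simp only [Finset.mem_insert, Finset.mem_singleton, Finset.mem_union, Finset.mem_inter] <;>
    omega

theorem exists_left_factorization {h : ℤ → Chain d} (hh : ∀ i, h i ∈ localAlg d {i, i + 1})
    (hinj : ∀ i, LieInjOn (h i) {i})
    {c : ℤ → Chain d} (hc : ∀ i, c i ∈ traceless d {i, i + 1, i + 1 + 1})
    (hcc : ∀ i, ⁅h i, c (i + 1)⁆ = ⁅c i, h (i + 1 + 1)⁆) :
    ∃ a : ℤ → Chain d, (∀ i, a i ∈ traceless d {i, i + 1}) ∧ ∀ i, c i = ⁅h i, a (i + 1)⁆ := by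
  choose L hL using fun j : ℤ =>
    exists_amplify_lie_eq (Finset.mem_insert_self j {j + 1}) (hh j) (hinj j)
  /- A left inverse of `ad h_{i+2}` on the site `i + 2` commutes with `ad h_i`; applied to
  `[h_i, c_{i+1}] = -[h_{i+2}, c_i]`, it expresses `c_i` as a commutator with `h_i`. -/
  refine ⟨fun i => -amplify {i + 1, i + 1 + 1} (L (i + 1)) (c i), fun i => neg_mem ?_, fun i => ?_⟩
  · exact amplify_mem (C := {i}) (A := {i + 1}) (B := {i + 1, i + 1 + 1}) (by simp)
      (by simp only [Finset.disjoint_singleton_left, Finset.mem_insert, Finset.mem_singleton]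
          omega) _ (hc i)
  · have hi : c i ∈ localAlg d ({i, i + 1} ∪ {i + 1 + 1}) :=
      localAlg_mono (by simp [Finset.insert_union]) (traceless_le_localAlg _ (hc i))
    rw [lie_neg, ← amplify_lie (by simp) _ (localAlg_le_centralizer (disjoint_pair_pair i) (hh i)),
      hcc, ← lie_skew, map_neg, neg_neg, hL _ _ (disjoint_pair_pair i) (c i) hi
      (siteTrace_traceless (by simp) (hc i))]

theorem exists_factorization {h : ℤ → Chain d} (hh : ∀ i, h i ∈ traceless d {i, i + 1})
    (hl : ∀ i, LieInjOn (h i) {i}) (hr : ∀ i, LieInjOn (h i) {i + 1})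
    {c : ℤ → Chain d} (hc : ∀ i, c i ∈ traceless d {i, i + 1, i + 1 + 1})
    (hcc : ∀ i, ⁅h i, c (i + 1)⁆ = ⁅c i, h (i + 1 + 1)⁆) :
    ∃ a : ℤ → Chain d, (∀ i, a i ∈ traceless d {i, i + 1}) ∧
      ∀ i, c i = ⁅h i, a (i + 1)⁆ ∧ c i = ⁅a i, h (i + 1)⁆ := by
  have hloc (i) : h i ∈ localAlg d {i, i + 1} := traceless_le_localAlg _ (hh i)
  obtain ⟨a, ha, hca⟩ := exists_left_factorization hloc hl hc hcc
  refine ⟨a, ha, fun i => ⟨hca i, ?_⟩⟩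
  obtain ⟨i, rfl⟩ : ∃ k, k + 1 = i := ⟨i - 1, sub_add_cancel i 1⟩
  have hmem : c (i + 1) - ⁅a (i + 1), h (i + 1 + 1)⁆ ∈
      traceless d {i + 1, i + 1 + 1, i + 1 + 1 + 1} :=
    sub_mem (hc (i + 1)) (lie_mem_traceless_triple (ha (i + 1)) (hh (i + 1 + 1)))
  refine sub_eq_zero.1 (eq_zero_of_lie_eq_zero (j := i + 1) (by simp; omega)
    (disjoint_pair_pair i) (hloc i) (hr i) (traceless_le_localAlg _ hmem)
    (siteTrace_traceless (by simp) hmem) ?_)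
  rw [lie_sub, leibniz_lie (h i), ← hca i,
    lie_eq_zero_of_disjoint (disjoint_pair_pair i) (hloc i) (hloc (i + 1 + 1)), lie_zero, add_zero,
    hcc, sub_self]

end Factorization

/-! ### Commutators of two-local operators -/

section TwoLocal

theorem toChain_adjacentComm (i : ℤ) (x : Op₀ d {i, i + 1}) (y : Op₀ d {i + 1, i + 1 + 1}) :
    toChain _ (adjacentComm i x y) = ⁅termOp {i, i + 1} x, termOp {i + 1, i + 1 + 1} y⁆ := by
  simp only [adjacentComm]
  rw [map_sub, map_mul, map_mul, toChain_embed, toChain_embed, Ring.lie_def]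
  rfl

theorem AtMostLocal.eq_singleton {Φ : FormalOp d} (hΦ : AtMostLocal 1 Φ) {A : Finset ℤ}
    (hA : Φ A ≠ 0) {i : ℤ} (hi : i ∈ A) : A = {i} := by
  obtain ⟨j, hj⟩ := hΦ A hA
  refine Finset.eq_singleton_iff_unique_mem.2 ⟨hi, fun x hx => ?_⟩
  have := Finset.mem_Ico.1 (hj hi)
  have := Finset.mem_Ico.1 (hj hx)
  omega

theorem AtMostLocal.one_of_two {Φ : FormalOp d} (hΦ : AtMostLocal 2 Φ)
    (h : ∀ i : ℤ, Φ {i, i + 1} = 0) : AtMostLocal 1 Φ := fun A hA => by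
  obtain ⟨i, hi⟩ := hΦ A hA
  simp only [Finset.subset_iff, Finset.mem_Ico] at hi ⊢
  by_cases h1 : i ∈ A
  · have h2 : i + 1 ∉ A := fun h2 => hA <| by
      rw [show A = {i, i + 1} by ext x; grind]
      exact h i
    exact ⟨i, fun x hx => by grind⟩
  · exact ⟨i + 1, fun x hx => by grind⟩

variable [NeZero d]

theorem translateChain_mem_traceless {A : Finset ℤ} {X : Chain d} :
    translateChain d X ∈ traceless d A ↔ X ∈ traceless d (shift A) := by
  refine ⟨fun h => ?_, fun h => ?_⟩
  · have hX := termOp_coeff_translateChain subset_rfl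
      (translateChain_mem_iff.1 (traceless_le_localAlg A h))
    rw [termOp_coeff h] at hX
    rw [(translateChain d).injective hX]
    exact termOp_mem_traceless _ _
  · rw [← termOp_coeff h,
      ← termOp_coeff_translateChain subset_rfl (traceless_le_localAlg (shift A) h)]
    exact termOp_mem_traceless _ _

theorem lieInjOn_translateChain {A : Finset ℤ} {h : Chain d} :
    LieInjOn (translateChain d h) A ↔ LieInjOn h (shift A) := by
  refine ⟨fun hh y hy hhy => ?_, fun hh y hy hhy => ?_⟩
  · have := hh (translateChain d y) (translateChain_mem_traceless.2 hy)
      (by rw [← translateChain_lie, hhy, map_zero])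
    exact (map_eq_zero_iff _ (translateChain d).injective).1 this
  · obtain ⟨x, rfl⟩ := (translateChain d).surjective y
    rw [← translateChain_lie, map_eq_zero_iff _ (translateChain d).injective] at hhy
    rw [hh x (translateChain_mem_traceless.1 hy) hhy, map_zero]

theorem lieInjOn_term_shift {H : FormalOp d} (hH : translateOp H = H) (A B : Finset ℤ) :
    LieInjOn (term (shift A) H) (shift B) ↔ LieInjOn (term A H) B := by
  conv_rhs => rw [← hH, term_translateOp, lieInjOn_translateChain]

theorem commute_embed_of_lie_eq_zero {A B : Finset ℤ} (h : A ⊆ B) {X : Op d A} {Y : Op d B}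
    (hXY : ⁅toChain B Y, toChain A X⁆ = 0) : Commute (embed h X) Y := by
  apply toChain_injective B
  rw [map_mul, map_mul, toChain_embed]
  exact (sub_eq_zero.1 hXY).symm

theorem InjectiveInteraction.lieInjOn {H : FormalOp d} (hH : InjectiveInteraction H)
    (hHT : translateOp H = H) (i : ℤ) :
    LieInjOn (term {i, i + 1} H) {i} ∧ LieInjOn (term {i, i + 1} H) {i + 1} := by
  let f (i : ℤ) : Prop :=
    LieInjOn (term {i, i + 1} H) {i} ∧ LieInjOn (term {i, i + 1} H) {i + 1}
  have hf (i : ℤ) : f ((1 : ℤ) +ᵥ i) = f i := by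
    have hp : shift {i, i + 1} = {i + 1, i + 1 + 1} := by simp [shift]
    have hl := lieInjOn_term_shift hHT {i, i + 1} {i}
    have hr := lieInjOn_term_shift hHT {i, i + 1} {i + 1}
    rw [hp, show shift {i} = {i + 1} by simp [shift]] at hl
    rw [hp, show shift {i + 1} = {i + 1 + 1} by simp [shift]] at hr
    rw [vadd_eq_add, add_comm]
    exact propext (and_congr hl hr)
  have h1 : f 1 := by
    constructor <;> rintro _ ⟨x, rfl⟩ h
    · rw [hH.2 x (commute_embed_of_lie_eq_zero (by simp) h), map_zero]
    · rw [hH.1 x (commute_embed_of_lie_eq_zero (by simp) h), map_zero]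
  have hi := eq_of_one_vadd_eq hf (i - 1) 1
  rw [vadd_eq_add, sub_add_cancel] at hi
  exact hi.mpr h1

theorem OneDimTwoLocal.exists_smul {H : FormalOp d} (hH : OneDimTwoLocal H) {a : ℤ → Chain d}
    (ha : ∀ i, a i ∈ traceless d {i, i + 1})
    (h : ∀ i, ⁅term {i, i + 1} H, a (i + 1)⁆ = ⁅a i, term {i + 1, i + 1 + 1} H⁆) :
    ∃ α : ℂ, ∀ i, a i = α • term {i, i + 1} H := by
  obtain ⟨α, hα⟩ := hH (fun i => coeff {i, i + 1} (a i)) fun i => by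
    apply toChain_injective
    rw [toChain_adjacentComm, toChain_adjacentComm, termOp_coeff (ha i),
      termOp_coeff (ha (i + 1))]
    exact h i
  refine ⟨α, fun i => ?_⟩
  rw [← termOp_coeff (ha i), hα i, map_smul]
  rfl

theorem Icc_add_one (i : ℤ) : Finset.Icc i (i + 1) = {i, i + 1} := by
  ext x; simp only [Finset.mem_Icc, Finset.mem_insert, Finset.mem_singleton]; omega

theorem Icc_add_two (i : ℤ) : Finset.Icc i (i + 1 + 1) = {i, i + 1, i + 1 + 1} := by
  ext x; simp only [Finset.mem_Icc, Finset.mem_insert, Finset.mem_singleton]; omega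

theorem term_opComm {Φ Ψ : FormalOp d} (hΦ : Φ ∈ finiteRange d) (hΨ : Ψ ∈ finiteRange d)
    {A : Finset ℤ} (S : Finset (Finset ℤ × Finset ℤ))
    (hS : ∀ C D, coeff A ⁅term C Φ, term D Ψ⁆ ≠ 0 → (C, D) ∈ S)
    (hmem : ∀ p ∈ S, ⁅term p.1 Φ, term p.2 Ψ⁆ ∈ traceless d A) :
    term A (opComm Φ Ψ) = ∑ p ∈ S, ⁅term p.1 Φ, term p.2 Ψ⁆ := by
  change termOp A (opComm Φ Ψ A) = _
  have hsupp : Function.support (fun p : Finset ℤ × Finset ℤ =>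
      coeff A ⁅term p.1 Φ, term p.2 Ψ⁆) ⊆ S := fun p hp => hS p.1 p.2 hp
  rw [opComm_eq_finsum hΦ hΨ, finsum_eq_sum_of_support_subset _ hsupp, map_sum]
  exact Finset.sum_congr rfl fun p hp => termOp_coeff (hmem p hp)

theorem Icc_union_Icc_and_inter {i j l : ℤ} (hij : i ≤ j) (hjl : j ≤ l) :
    Finset.Icc i j ∪ Finset.Icc j l = Finset.Icc i l ∧
      Finset.Icc i j ∩ Finset.Icc j l = {j} := by
  constructor <;> ext x <;> simp only [Finset.mem_union, Finset.mem_inter, Finset.mem_Icc,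
    Finset.mem_singleton] <;> omega

theorem eq_Icc_of_union_cover {m n : ℕ} (hm : 0 < m) (hn : 0 < n) {C D : Finset ℤ} {p q i : ℤ}
    (hC : C ⊆ Finset.Ico p (p + (m + 1 : ℕ))) (hD : D ⊆ Finset.Ico q (q + (n + 1 : ℕ)))
    (hCD : ¬ Disjoint C D) (h : Finset.Icc i (i + m + n) ⊆ C ∪ D) (hi : i ∈ C) :
    C = Finset.Icc i (i + m) ∧ D = Finset.Icc (i + m) (i + m + n) := by
  obtain ⟨x, hxC, hxD⟩ := Finset.not_disjoint_iff.1 hCD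
  simp only [Finset.subset_iff, Finset.mem_Ico, Finset.mem_Icc, Finset.mem_union] at hC hD h
  have hl : i + m + n ∈ D := (h (by omega)).resolve_left fun hl => by
    have := hC hl; have := hC hi; have := hC hxC; have := hD hxD; omega
  have h₁ := hC hi
  have h₂ := hC hxC
  have h₃ := hD hl
  have h₄ := hD hxD
  have hp : p = i := by omega
  have hq : q = i + m := by omega
  obtain rfl : x = i + m := by omega
  constructor <;> ext y <;> rw [Finset.mem_Icc] <;> refine ⟨fun hy => ?_, fun hy => ?_⟩
  · have := hC hy; omega
  · refine (h (by omega)).elim id fun hyD => ?_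
    obtain rfl : y = i + m := by have := hD hyD; omega
    exact hxC
  · have := hD hy; omega
  · refine (h (by omega)).elim (fun hyC => ?_) id
    obtain rfl : y = i + m := by have := hC hyC; omega
    exact hxD

theorem term_opComm_Icc {m n : ℕ} (hm : 0 < m) (hn : 0 < n) {Φ Ψ : FormalOp d}
    (hΦ : AtMostLocal (m + 1) Φ) (hΨ : AtMostLocal (n + 1) Ψ) (i : ℤ) :
    term (Finset.Icc i (i + m + n)) (opComm Φ Ψ) =
      ⁅term (Finset.Icc i (i + m)) Φ, term (Finset.Icc (i + m) (i + m + n)) Ψ⁆ +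
      ⁅term (Finset.Icc (i + n) (i + m + n)) Φ, term (Finset.Icc i (i + n)) Ψ⁆ := by
  have hne : (Finset.Icc i (i + m), Finset.Icc (i + m) (i + m + n)) ≠
      (Finset.Icc (i + n) (i + m + n), Finset.Icc i (i + n)) := fun h => by
    have : i ∈ Finset.Icc (i + n) (i + m + n) := (Prod.mk.inj h).1 ▸ Finset.mem_Icc.2 (by omega)
    rw [Finset.mem_Icc] at this
    omega
  have hadd : i + n + m = i + m + n := by omega
  rw [term_opComm hΦ.mem_finiteRange hΨ.mem_finiteRange {(_, _), (_, _)}, Finset.sum_pair hne]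
  · intro C D h
    obtain ⟨hC, hD, hCD, -, hsub⟩ := coeff_lie_term_ne_zero h
    obtain ⟨p, hp⟩ := hΦ C hC
    obtain ⟨q, hq⟩ := hΨ D hD
    rw [Finset.mem_insert, Finset.mem_singleton, Prod.mk.injEq, Prod.mk.injEq]
    rcases Finset.mem_union.1 (hsub (Finset.mem_Icc.2 (by omega : i ≤ i ∧ i ≤ i + m + n)))
      with hi | hi
    · exact .inl (eq_Icc_of_union_cover hm hn hp hq hCD hsub hi)
    · rw [← hadd, Finset.union_comm] at hsub
      exact .inr (hadd ▸ (eq_Icc_of_union_cover hn hm hq hp (fun h => hCD h.symm) hsub hi).symm)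
  · simp only [Finset.mem_insert, Finset.mem_singleton, forall_eq_or_imp, forall_eq]
    constructor
    · have := Icc_union_Icc_and_inter (i := i) (j := i + m) (l := i + m + n) (by omega) (by omega)
      exact lie_mem_traceless this.1 this.2 (term_mem_traceless _ _) (term_mem_traceless _ _)
    · have := Icc_union_Icc_and_inter (i := i) (j := i + n) (l := i + m + n) (by omega) (by omega)
      rw [Finset.union_comm, Finset.inter_comm] at this
      exact lie_mem_traceless this.1 this.2 (term_mem_traceless _ _) (term_mem_traceless _ _)

theorem term_opComm_triple {Φ Ψ : FormalOp d} (hΦ : AtMostLocal 2 Φ) (hΨ : AtMostLocal 2 Ψ)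
    (i : ℤ) : term {i, i + 1, i + 1 + 1} (opComm Φ Ψ) =
      ⁅term {i, i + 1} Φ, term {i + 1, i + 1 + 1} Ψ⁆ +
      ⁅term {i + 1, i + 1 + 1} Φ, term {i, i + 1} Ψ⁆ := by
  simpa [Icc_add_one, Icc_add_two] using term_opComm_Icc one_pos one_pos hΦ hΨ i

theorem term_opComm_quadruple {Φ Ψ : FormalOp d} (hΦ : AtMostLocal 2 Φ) (hΨ : AtMostLocal 3 Ψ)
    (i : ℤ) : term (Finset.Icc i (i + 1 + 1 + 1)) (opComm Φ Ψ) =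
      ⁅term {i, i + 1} Φ, term {i + 1, i + 1 + 1, i + 1 + 1 + 1} Ψ⁆ +
      ⁅term {i + 1 + 1, i + 1 + 1 + 1} Φ, term {i, i + 1, i + 1 + 1} Ψ⁆ := by
  have h := term_opComm_Icc one_pos two_pos hΦ hΨ i
  rw [show i + (2 : ℕ) = i + 1 + 1 by push_cast; ring,
    show i + (1 : ℕ) + (2 : ℕ) = i + 1 + 1 + 1 by push_cast; ring] at h
  simpa [Icc_add_one, Icc_add_two] using h

theorem lie_term_singleton_mem_traceless (Φ Ψ : FormalOp d) {A : Finset ℤ} {x : ℤ} (hx : x ∈ A) :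
    ⁅term A Φ, term {x} Ψ⁆ ∈ traceless d A :=
  lie_mem_traceless (i := x) (by simpa using hx) (by simpa using hx) (term_mem_traceless _ _)
    (term_mem_traceless _ _)

theorem exists_eq_singleton_of_coeff_lie_ne_zero {Φ Ψ : FormalOp d} (hΨ : AtMostLocal 1 Ψ)
    {A C D : Finset ℤ} (h : coeff A ⁅term C Φ, term D Ψ⁆ ≠ 0) : C = A ∧ ∃ x ∈ A, D = {x} := by
  obtain ⟨-, hD, hCD, -⟩ := coeff_lie_term_ne_zero h
  obtain ⟨x, hxC, hxD⟩ := Finset.not_disjoint_iff.1 hCD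
  obtain rfl := hΨ.eq_singleton hD hxD
  have hCA : C = A := by
    by_contra hne
    exact h (coeff_of_mem_of_ne hne (lie_term_singleton_mem_traceless Φ Ψ hxC))
  exact ⟨hCA, x, hCA ▸ hxC, rfl⟩

theorem term_opComm_one_local {Φ Ψ : FormalOp d} (hΦ : Φ ∈ finiteRange d)
    (hΨ : AtMostLocal 1 Ψ) (A : Finset ℤ) :
    term A (opComm Φ Ψ) = ∑ x ∈ A, ⁅term A Φ, term {x} Ψ⁆ := by
  rw [term_opComm hΦ hΨ.mem_finiteRange (A.image fun x => (A, {x})), Finset.sum_image]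
  · exact fun x _ y _ h => Finset.singleton_injective (Prod.mk.inj h).2
  · intro C D h
    obtain ⟨rfl, x, hx, rfl⟩ := exists_eq_singleton_of_coeff_lie_ne_zero hΨ h
    exact Finset.mem_image_of_mem _ hx
  · intro p hp
    obtain ⟨x, hx, rfl⟩ := Finset.mem_image.1 hp
    exact lie_term_singleton_mem_traceless Φ Ψ hx

end TwoLocal

section OneLocal

variable [NeZero d] {H S : FormalOp d}

theorem lie_term_eq_zero (hH : IsSelfAdj H) {A : Finset ℤ} {X : Chain d}
    (hX : X ∈ localAlg d A) (h : ⁅term A H, ⁅term A H, X⁆⁆ = 0) : ⁅term A H, X⁆ = 0 := by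
  obtain ⟨Y, rfl⟩ : ∃ Y, toChain A Y = X := hX
  have hlie (Z : Op d A) : ⁅term A H, toChain A Z⁆ = toChain A ⁅(H A : Op d A), Z⁆ := by
    rw [Ring.lie_def, Ring.lie_def, map_sub, map_mul, map_mul]
    rfl
  rw [hlie, hlie, map_eq_zero_iff _ (toChain_injective A)] at h
  rw [hlie, lie_eq_zero_of_isHermitian (hH A) h, map_zero]

theorem opComm_apply_eq_zero_of_one_local (hH : H ∈ finiteRange d) (hH_sa : IsSelfAdj H)
    (hS : AtMostLocal 1 S) {A : Finset ℤ} (h : ⁅term A H, term A (opComm H S)⁆ = 0) :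
    opComm H S A = 0 := by
  have hG : term A (opComm H S) = ⁅term A H, ∑ x ∈ A, term {x} S⁆ := by
    rw [term_opComm_one_local hH hS, lie_sum]
  have hmem : ∑ x ∈ A, term {x} S ∈ localAlg d A := sum_mem fun x hx =>
    localAlg_mono (Finset.singleton_subset_iff.2 hx) (term_mem {x} S)
  rw [← term_eq_zero_iff, hG]
  exact lie_term_eq_zero hH_sa hmem (hG ▸ h)

theorem opComm_eq_zero_of_one_local (hH : AtMostLocal 2 H) (hH_sa : IsSelfAdj H)
    (hH_one : OneDimTwoLocal H) (hS : AtMostLocal 1 S) (h : opComm H (opComm H S) = 0) :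
    opComm H S = 0 := by
  have hHf : H ∈ finiteRange d := hH.mem_finiteRange
  have hG2 : AtMostLocal 2 (opComm H S) := hH.opComm (m := 2) (n := 1) (by omega) hS
  have hG1 : AtMostLocal 1 (opComm H S) := hG2.one_of_two fun i => by
    obtain ⟨γ, hγ⟩ := hH_one.exists_smul (a := fun i => term {i, i + 1} (opComm H S))
      (fun i => term_mem_traceless _ _) fun i => by
        have hi := term_opComm_triple hH hG2 i
        rw [h, map_zero] at hi
        rw [← lie_skew (term {i, i + 1} (opComm H S)), eq_neg_iff_add_eq_zero]
        exact hi.symm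
    refine opComm_apply_eq_zero_of_one_local hHf hH_sa hS ?_
    rw [hγ i, lie_smul, lie_self, smul_zero]
  refine funext fun A => ?_
  by_contra hA
  obtain rfl | ⟨i, hi⟩ := A.eq_empty_or_nonempty
  · exact hA (opComm_empty hHf hS.mem_finiteRange)
  · obtain rfl := hG1.eq_singleton hA hi
    refine hA (opComm_apply_eq_zero_of_one_local hHf hH_sa hS ?_)
    have hsite := term_opComm_one_local hHf hG1 {i}
    rw [h, map_zero, Finset.sum_singleton] at hsite
    exact hsite.symm

theorem lie_eq_zero_of_one_local {H S : finiteRange d} (hH : AtMostLocal 2 (H : FormalOp d))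
    (hH_sa : IsSelfAdj (H : FormalOp d)) (hH_one : OneDimTwoLocal (H : FormalOp d))
    (hS : AtMostLocal 1 (S : FormalOp d)) (h : ⁅H, ⁅H, S⁆⁆ = 0) : ⁅H, S⁆ = 0 :=
  Subtype.ext (opComm_eq_zero_of_one_local hH hH_sa hH_one hS (congrArg Subtype.val h))

end OneLocal

/-! ### Boost operators -/

section Boost

theorem AtMostLocal.standardBoost {n : ℕ} {H : FormalOp d} (hH : AtMostLocal n H) :
    AtMostLocal n (standardBoost H) := fun A hA => hH A fun h => hA <| by
  simp only [SpinChain.standardBoost, h, smul_zero, dite_eq_ite, ite_self]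

theorem standardBoost_mem_finiteRange {H : FormalOp d} (hH : H ∈ finiteRange d) :
    standardBoost H ∈ finiteRange d := by
  obtain ⟨n, hn⟩ := mem_finiteRange.1 hH
  exact hn.standardBoost.mem_finiteRange

theorem standardBoost_apply {A : Finset ℤ} {i : ℤ} (hi : IsLeast (A : Set ℤ) i) (H : FormalOp d) :
    standardBoost H A = (i : ℂ) • H A := by
  have hA : A.Nonempty := ⟨i, hi.1⟩
  rw [standardBoost, dif_pos hA, (A.isLeast_min' hA).unique hi]

theorem standardBoost_pair (H : FormalOp d) (i : ℤ) :
    standardBoost H {i, i + 1} = (i : ℂ) • H {i, i + 1} :=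
  standardBoost_apply ⟨by simp, by simp⟩ H

theorem isLeast_shift {A : Finset ℤ} {i : ℤ} (hi : IsLeast (A : Set ℤ) i) :
    IsLeast (shift A : Set ℤ) (i + 1) := by
  refine ⟨mem_shift.2 (by simpa using hi.1), fun j hj => ?_⟩
  have := hi.2 (mem_shift.1 hj)
  omega

theorem translateOp_standardBoost_apply {H : FormalOp d} (hH : translateOp H = H) {A : Finset ℤ}
    (hA : A.Nonempty) : translateOp (standardBoost H) A = (standardBoost H + H) A := by
  have hmin := A.isLeast_min' hA
  have h : translateOp (standardBoost H) A = ((A.min' hA + 1 : ℤ) : ℂ) • translateOp H A := by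
    refine Subtype.ext ?_
    ext s t
    change (standardBoost H (shift A) : Op d (shift A)) (shiftConfig s) (shiftConfig t) = _
    rw [standardBoost_apply (isLeast_shift hmin)]
    rfl
  rw [h, hH, Pi.add_apply, standardBoost_apply hmin, Int.cast_add, Int.cast_one, add_smul, one_smul]

variable [NeZero d]

theorem opComm_congr_left {Φ Φ' Ψ : FormalOp d} (hΦ : Φ ∈ finiteRange d) (hΦ' : Φ' ∈ finiteRange d)
    (hΨ : Ψ ∈ finiteRange d) (h : ∀ A : Finset ℤ, A.Nonempty → Φ A = Φ' A) :
    opComm Φ Ψ = opComm Φ' Ψ := by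
  funext A
  rw [opComm_eq_finsum hΦ hΨ, opComm_eq_finsum hΦ' hΨ]
  refine finsum_congr fun p => ?_
  obtain hp | hp := p.1.eq_empty_or_nonempty
  · have hd : Disjoint p.1 p.2 := hp ▸ Finset.disjoint_empty_left _
    rw [lie_eq_zero_of_disjoint hd (term_mem _ Φ) (term_mem _ Ψ),
      lie_eq_zero_of_disjoint hd (term_mem _ Φ') (term_mem _ Ψ)]
  · rw [show term p.1 Φ = term p.1 Φ' from congrArg (termOp p.1) (h p.1 hp)]

theorem opComm_standardBoost_eq_zero {H S : FormalOp d} (hH : H ∈ finiteRange d)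
    (hS : AtMostLocal 1 S) (h : opComm H S = 0) : opComm (standardBoost H) S = 0 := by
  refine formalOp_ext fun A => ?_
  rw [term_opComm_one_local (standardBoost_mem_finiteRange hH) hS, map_zero]
  obtain rfl | hA := A.eq_empty_or_nonempty
  · exact Finset.sum_empty
  have hHS := term_opComm_one_local hH hS A
  have hboost : term A (standardBoost H) = ((A.min' hA : ℤ) : ℂ) • term A H := by
    rw [← map_smul]
    exact congrArg (termOp A) (standardBoost_apply (A.isLeast_min' hA) H)
  simp only [hboost, smul_lie]
  rw [← Finset.smul_sum, ← hHS, h, map_zero, smul_zero]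

theorem exists_linear_interaction {H B : FormalOp d} (hH : AtMostLocal 2 H)
    (hHT : translateOp H = H) (hH_inj : InjectiveInteraction H) (hH_one : OneDimTwoLocal H)
    (hB : AtMostLocal 2 B) (hQ : opComm H (opComm B H) = 0) :
    ∃ α β : ℂ, ∀ i : ℤ, B {i, i + 1} = (α * i + β) • H {i, i + 1} := by
  have hQ3 : AtMostLocal 3 (opComm B H) := hB.opComm (by omega) hH
  obtain ⟨a, ha, hfac⟩ := exists_factorization (h := fun i => term {i, i + 1} H)
    (fun i => term_mem_traceless _ _) (fun i => (hH_inj.lieInjOn hHT i).1)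
    (fun i => (hH_inj.lieInjOn hHT i).2)
    (c := fun i => term {i, i + 1, i + 1 + 1} (opComm B H))
    (fun i => term_mem_traceless _ _) fun i => by
      have h := term_opComm_quadruple hH hQ3 i
      rw [hQ, map_zero] at h
      rw [← lie_skew (term {i, i + 1, i + 1 + 1} _), eq_neg_iff_add_eq_zero]
      exact h.symm
  obtain ⟨γ, hγ⟩ := hH_one.exists_smul ha fun i => (hfac i).1.symm.trans (hfac i).2
  obtain ⟨β, hβ⟩ := hH_one.exists_smul
    (a := fun i : ℤ => term {i, i + 1} B - (-γ * i) • term {i, i + 1} H)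
    (fun i => sub_mem (term_mem_traceless _ _)
      (Submodule.smul_mem _ _ (term_mem_traceless _ _))) fun i => by
      have h := (hfac i).2
      simp only [term_opComm_triple hB hH, hγ] at h
      rw [← lie_skew (term {i + 1, i + 1 + 1} B), smul_lie] at h
      simp only [lie_sub, sub_lie, lie_smul, smul_lie]
      push_cast
      linear_combination (norm := module) -h
  refine ⟨-γ, β, fun i => termOp_injective _ ?_⟩
  rw [map_smul]
  change term {i, i + 1} B = _ • term {i, i + 1} H
  rw [sub_eq_iff_eq_add.1 (hβ i)]
  module

theorem interaction_ne_zero {H B : FormalOp d} (hH : AtMostLocal 2 H) (hHT : translateOp H = H)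
    (hH_inj : InjectiveInteraction H) (hB : AtMostLocal 2 B) (hQ : opComm B H ≠ 0) (i : ℤ) :
    H {i, i + 1} ≠ 0 := fun h0 => hQ <| by
  have hpair (j : ℤ) : H {j, j + 1} = 0 := by
    have hf (j : ℤ) : (H {(1 : ℤ) +ᵥ j, ((1 : ℤ) +ᵥ j) + 1} = 0) = (H {j, j + 1} = 0) := by
      rw [← term_eq_zero_iff, ← term_eq_zero_iff]
      conv_rhs => rw [← hHT, term_translateOp, map_eq_zero_iff _ (translateChain d).injective]
      rw [vadd_eq_add, add_comm, show shift {j, j + 1} = {j + 1, j + 1 + 1} by simp [shift]]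
    have hji := eq_of_one_vadd_eq (f := fun j => H {j, j + 1} = 0) hf (j - i) i
    rw [vadd_eq_add, sub_add_cancel] at hji
    exact hji.mpr h0
  have hsite (j : ℤ) : term {j} H = 0 := (hH_inj.lieInjOn hHT j).1 _ (term_mem_traceless _ _) <| by
    rw [term_eq_zero_iff.2 (hpair j), zero_lie]
  refine formalOp_ext fun A => ?_
  rw [term_opComm_one_local hB.mem_finiteRange (hH.one_of_two hpair), map_zero]
  exact Finset.sum_eq_zero fun x _ => by rw [hsite, lie_zero]

end Boost

section BoostForm

theorem im_eq_zero_of_isHermitian_smul {n : Type*} {M : Matrix n n ℂ} {z : ℂ}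
    (hM : M.IsHermitian) (hM0 : M ≠ 0) (hz : (z • M).IsHermitian) : z.im = 0 := by
  have h : (star z - z) • M = 0 := by
    have := hz.eq
    rwa [Matrix.conjTranspose_smul, hM.eq, ← sub_eq_zero, ← sub_smul] at this
  exact Complex.conj_eq_iff_im.1 (sub_eq_zero.1 ((smul_eq_zero.1 h).resolve_right hM0))

theorem IsSelfAdj.exists_ofReal {H B : FormalOp d} (hH : IsSelfAdj H) (hB : IsSelfAdj B)
    {α β : ℂ} (h : ∀ i : ℤ, B {i, i + 1} = (α * i + β) • H {i, i + 1})
    (hne : ∀ i : ℤ, H {i, i + 1} ≠ 0) : ∃ x y : ℝ, (x : ℂ) = α ∧ (y : ℂ) = β := by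
  have him (i : ℤ) : (α * i + β).im = 0 := by
    refine im_eq_zero_of_isHermitian_smul (hH {i, i + 1}) (fun h0 => hne i (Subtype.ext h0)) ?_
    have := hB {i, i + 1}
    rwa [h i] at this
  have hβ : β.im = 0 := by simpa using him 0
  have hα : α.im = 0 := by simpa [hβ] using him 1
  exact ⟨α.re, β.re, Complex.ext rfl hα.symm, Complex.ext rfl hβ.symm⟩

variable [NeZero d] {H B R : finiteRange d}

theorem slope_ne_zero (hH : AtMostLocal 2 (H : FormalOp d)) (hH_sa : IsSelfAdj (H : FormalOp d))
    (hH_one : OneDimTwoLocal (H : FormalOp d)) (hB : AtMostLocal 2 (B : FormalOp d)) {α β : ℂ}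
    (h : ∀ i : ℤ, (B : FormalOp d) {i, i + 1} = (α * i + β) • (H : FormalOp d) {i, i + 1})
    (hQ_ne : ⁅B, H⁆ ≠ 0) (hQ : ⁅H, ⁅B, H⁆⁆ = 0) : α ≠ 0 := by
  rintro rfl
  have hS : AtMostLocal 1 (B - β • H : FormalOp d) := by
    refine AtMostLocal.one_of_two ((atMostLocal d 2).sub_mem hB
      ((atMostLocal d 2).smul_mem β hH)) fun i => ?_
    rw [Pi.sub_apply, Pi.smul_apply, h i, zero_mul, zero_add, sub_self]
  have hHS : ⁅H, B - β • H⁆ = -⁅B, H⁆ := by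
    rw [lie_sub, lie_smul, lie_self, smul_zero, sub_zero, lie_skew]
  refine hQ_ne (neg_eq_zero.1 (hHS ▸ lie_eq_zero_of_one_local hH hH_sa hH_one hS ?_))
  rw [hHS, lie_neg, hQ, neg_zero]

theorem exists_boost_form (hH : AtMostLocal 2 (H : FormalOp d))
    (hH_sa : IsSelfAdj (H : FormalOp d)) (hHT : translateOp (H : FormalOp d) = H)
    (hH_inj : InjectiveInteraction (H : FormalOp d)) (hH_one : OneDimTwoLocal (H : FormalOp d))
    (hB : AtMostLocal 2 (B : FormalOp d)) (hB_sa : IsSelfAdj (B : FormalOp d))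
    (hQ_ne : ⁅B, H⁆ ≠ 0) (hQ : ⁅H, ⁅B, H⁆⁆ = 0) :
    ∃ (c a : ℝ) (R : FormalOp d), c ≠ 0 ∧ AtMostLocal 1 R ∧
      B = (c : ℂ) • (standardBoost (H : FormalOp d) + R + (a : ℂ) • (H : FormalOp d)) := by
  obtain ⟨α, β, h⟩ :=
    exists_linear_interaction hH hHT hH_inj hH_one hB (congrArg Subtype.val hQ)
  obtain ⟨c, b, rfl, rfl⟩ := hH_sa.exists_ofReal hB_sa h fun i =>
    interaction_ne_zero hH hHT hH_inj hB (fun h0 => hQ_ne (Subtype.ext h0)) i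
  have hc : (c : ℂ) ≠ 0 := slope_ne_zero hH hH_sa hH_one hB h hQ_ne hQ
  have hR : AtMostLocal 1 ((B : FormalOp d) - (c : ℂ) • standardBoost (H : FormalOp d) -
      (b : ℂ) • (H : FormalOp d)) := by
    refine AtMostLocal.one_of_two ((atMostLocal d 2).sub_mem
      ((atMostLocal d 2).sub_mem hB ((atMostLocal d 2).smul_mem _ hH.standardBoost))
      ((atMostLocal d 2).smul_mem _ hH)) fun i => ?_
    rw [Pi.sub_apply, Pi.sub_apply, Pi.smul_apply, Pi.smul_apply, h i, standardBoost_pair]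
    module
  refine ⟨c, b / c, (c : ℂ)⁻¹ • _, by exact_mod_cast hc, Submodule.smul_mem (atMostLocal d 1) _ hR,
    ?_⟩
  rw [smul_add, smul_add, smul_inv_smul₀ hc, smul_smul, Complex.ofReal_div, mul_div_cancel₀ _ hc]
  abel

variable {c a : ℂ} (hBform : (B : FormalOp d) =
  c • (standardBoost (H : FormalOp d) + (R : FormalOp d) + a • (H : FormalOp d)))

include hBform

theorem lie_translate_sub (hHT : translateOp (H : FormalOp d) = H) (Ψ : finiteRange d) :
    ⁅translate d B - B, Ψ⁆ = c • (⁅H, Ψ⁆ + ⁅translate d R - R, Ψ⁆) := by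
  rw [← add_lie, ← smul_lie]
  refine Subtype.ext (opComm_congr_left (Subtype.property _) (Subtype.property _) Ψ.2
    fun A hA => ?_)
  have hboost := translateOp_standardBoost_apply hHT hA
  have hTB : translateOp (B : FormalOp d) A = c • (translateOp (standardBoost (H : FormalOp d)) A +
      translateOp (R : FormalOp d) A + a • translateOp (H : FormalOp d) A) := by
    rw [hBform]
    rfl
  change translateOp (B : FormalOp d) A - (B : FormalOp d) A =
    c • ((H : FormalOp d) A + (translateOp (R : FormalOp d) A - (R : FormalOp d) A))
  rw [hTB, hboost, hHT, hBform]
  simp only [Pi.add_apply, Pi.smul_apply]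
  module

theorem lie_boost {S : finiteRange d} (hS : AtMostLocal 1 (S : FormalOp d)) (hHS : ⁅H, S⁆ = 0) :
    ⁅S, B⁆ = c • ⁅S, R⁆ := by
  let b : finiteRange d := ⟨standardBoost H, standardBoost_mem_finiteRange H.2⟩
  have hbS : ⁅b, S⁆ = 0 :=
    Subtype.ext (opComm_standardBoost_eq_zero H.2 hS (congrArg Subtype.val hHS))
  have hB : B = c • (b + R + a • H) := Subtype.ext hBform
  rw [hB, lie_smul, lie_add, lie_add, lie_smul, ← lie_skew S b, ← lie_skew S H, hbS, hHS, neg_zero,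
    smul_zero, zero_add, add_zero]

end BoostForm

section Hierarchy

variable [NeZero d]

theorem atMostLocal_iterate_opComm {H B : FormalOp d} (hH : AtMostLocal 2 H)
    (hB : AtMostLocal 2 B) (n : ℕ) : AtMostLocal (n + 2) ((opComm B)^[n] H) := by
  induction n with
  | zero => exact hH
  | succ n ih =>
    rw [Function.iterate_succ_apply']
    exact AtMostLocal.opComm (m := 2) (n := n + 2) (by omega) hB ih

theorem coe_iterate_lie (B H : finiteRange d) (n : ℕ) :
    ((⁅B, ·⁆)^[n] H : finiteRange d) = (opComm (B : FormalOp d))^[n] H :=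
  (show Function.Semiconj Subtype.val (⁅B, ·⁆) (opComm (B : FormalOp d)) from
    fun _ => rfl).iterate_right n H

variable {H B R : finiteRange d} {c a : ℂ}

theorem lie_translate_sub_self_eq_zero (hH : AtMostLocal 2 (H : FormalOp d))
    (hH_sa : IsSelfAdj (H : FormalOp d)) (hHT : translate d H = H)
    (hH_one : OneDimTwoLocal (H : FormalOp d)) (hQ : ⁅H, ⁅B, H⁆⁆ = 0) (hc : c ≠ 0)
    (hR : AtMostLocal 1 (R : FormalOp d)) (hBform : (B : FormalOp d) =
      c • (standardBoost (H : FormalOp d) + (R : FormalOp d) + a • (H : FormalOp d))) :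
    ⁅H, translate d R - R⁆ = 0 := by
  have hQT : translate d ⁅B, H⁆ - ⁅B, H⁆ = c • ⁅translate d R - R, H⁆ := by
    rw [LieHom.map_lie, hHT, ← sub_lie, lie_translate_sub hBform (congrArg Subtype.val hHT),
      lie_self, zero_add]
  have hHQT : ⁅H, translate d ⁅B, H⁆⁆ = 0 := by
    rw [← congrArg (⁅·, translate d ⁅B, H⁆⁆) hHT, ← LieHom.map_lie, hQ, map_zero]
  refine lie_eq_zero_of_one_local hH hH_sa hH_one ((atMostLocal d 1).sub_mem hR.translateOp hR) ?_
  have h : c • ⁅H, ⁅translate d R - R, H⁆⁆ = 0 := by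
    rw [← lie_smul, ← hQT, lie_sub, hHQT, hQ, sub_zero]
  rw [← lie_skew H (translate d R - R), lie_neg, (smul_eq_zero.1 h).resolve_left hc, neg_zero]

theorem lie_iterate_eq_zero_of_one_local (hH : AtMostLocal 2 (H : FormalOp d))
    (hH_sa : IsSelfAdj (H : FormalOp d)) (hH_one : OneDimTwoLocal (H : FormalOp d))
    (hQ : ⁅H, ⁅B, H⁆⁆ = 0) (hR : AtMostLocal 1 (R : FormalOp d))
    (hBform : (B : FormalOp d) =
      c • (standardBoost (H : FormalOp d) + (R : FormalOp d) + a • (H : FormalOp d)))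
    {S : finiteRange d} (hS : AtMostLocal 1 (S : FormalOp d)) (hHS : ⁅H, S⁆ = 0) (n : ℕ) :
    ⁅S, (⁅B, ·⁆)^[n] H⁆ = 0 := by
  refine lie_iterate_eq_zero_of_double_lie {S : finiteRange d | AtMostLocal 1 (S : FormalOp d)}
    (fun S hS => lie_eq_zero_of_one_local hH hH_sa hH_one hS) (fun S hS hHS => ?_) ?_ hS hHS n
  · rw [lie_boost hBform hS hHS]
    exact (atMostLocal d 1).smul_mem c (hS.opComm (m := 1) (n := 1) le_rfl hR)
  · rw [← lie_skew H B, lie_neg, hQ, neg_zero]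

theorem translate_iterate_lie_and_lie_iterate_eq_zero (hH : AtMostLocal 2 (H : FormalOp d))
    (hH_sa : IsSelfAdj (H : FormalOp d)) (hHT : translate d H = H)
    (hH_one : OneDimTwoLocal (H : FormalOp d)) (hQ : ⁅H, ⁅B, H⁆⁆ = 0) (hc : c ≠ 0)
    (hR : AtMostLocal 1 (R : FormalOp d)) (hBform : (B : FormalOp d) =
      c • (standardBoost (H : FormalOp d) + (R : FormalOp d) + a • (H : FormalOp d))) (n : ℕ) :
    translate d ((⁅B, ·⁆)^[n] H) = (⁅B, ·⁆)^[n] H ∧ ⁅H, (⁅B, ·⁆)^[n] H⁆ = 0 := by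
  have hS : AtMostLocal 1 (translate d R - R : finiteRange d).1 :=
    (atMostLocal d 1).sub_mem hR.translateOp hR
  refine lie_iterate_invariant_of_double_lie (translate d) hHT
    (fun Ψ hΨT => lie_eq_zero_of_lie_lie_eq_zero hH_sa hHT hΨT) ?_ (fun n hn => ?_) n
  · rw [← lie_skew H B, lie_neg, hQ, neg_zero]
  · rw [lie_translate_sub hBform (congrArg Subtype.val hHT), hn,
      lie_iterate_eq_zero_of_one_local hH hH_sa hH_one hQ hR hBform hS
        (lie_translate_sub_self_eq_zero hH hH_sa hHT hH_one hQ hc hR hBform) n,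
      add_zero, smul_zero]

end Hierarchy

end SpinChain

end

theorem theorem2 {d : ℕ} (hd : 0 < d) (H B : FormalOp d)
    (hH_loc : AtMostLocal 2 H) (hH_sa : IsSelfAdj H) (hH_inv : translateOp H = H)
    (hH_inj : InjectiveInteraction H) (hH_one : OneDimTwoLocal H)
    (hB_loc : AtMostLocal 2 B) (hB_sa : IsSelfAdj B)
    (hQ_ne : opComm B H ≠ 0) (hQ_cons : IsConserved H (opComm B H)) :
    (∀ n : ℕ, 2 ≤ n → AtMostLocal n (charge H B n) ∧
      translateOp (charge H B n) = charge H B n ∧ IsConserved H (charge H B n)) ∧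
    (∀ m n : ℕ, 2 ≤ m → 2 ≤ n → opComm (charge H B m) (charge H B n) = 0) ∧
    ∃ (c a : ℝ) (R : FormalOp d), c ≠ 0 ∧ AtMostLocal 1 R ∧
      opComm H (translateOp R - R) = 0 ∧
      B = (c : ℂ) • (standardBoost H + R + (a : ℂ) • H) := by
  have : NeZero d := ⟨hd.ne'⟩
  lift H to finiteRange d using hH_loc.mem_finiteRange
  lift B to finiteRange d using hB_loc.mem_finiteRange
  have hHT : translate d H = H := Subtype.ext hH_inv
  have hQ : ⁅H, ⁅B, H⁆⁆ = 0 := Subtype.ext hQ_cons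
  obtain ⟨c, a, R, hc, hR, hB⟩ := exists_boost_form hH_loc hH_sa hH_inv hH_inj hH_one hB_loc hB_sa
    (fun h => hQ_ne (congrArg Subtype.val h)) hQ
  lift R to finiteRange d using hR.mem_finiteRange
  have hc' : (c : ℂ) ≠ 0 := Complex.ofReal_ne_zero.2 hc
  have hcharge := translate_iterate_lie_and_lie_iterate_eq_zero hH_loc hH_sa hHT hH_one hQ hc' hR hB
  simp only [charge, ← coe_iterate_lie]
  refine ⟨fun n hn => ⟨?_, congrArg Subtype.val (hcharge _).1, congrArg Subtype.val (hcharge _).2⟩,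
    fun m n _ _ => congrArg Subtype.val (lie_iterate_eq_zero (fun k => (hcharge k).2) _ _),
    c, a, R, hc, hR, congrArg Subtype.val <|
      lie_translate_sub_self_eq_zero hH_loc hH_sa hHT hH_one hQ hc' hR hB, hB⟩
  obtain ⟨k, rfl⟩ := Nat.exists_eq_add_of_le' hn
  rw [coe_iterate_lie]
  exact atMostLocal_iterate_opComm hH_loc hB_loc k
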